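/- **Model.** Fix $R$, block numbers $K_1,\dots,K_R$, dimensions $d_1,\dots,d_R$ and $D=\sum_i d_i$. Let $\pi$ be a probability vector on $[R]$ and, for each $i\in[R]$, $\pi_i$ a probability vector on $[K_i]$, all with strictly positive entries, and let $\xi^{(2)}_i(:,j)\in\mathbb{R}^{D}$ ($i\in[R]$, $j\in[K_i]$) be distinct vectors, the rows of the matrix $\xi\in\mathbb{R}^{(\sum_i K_i)\times D}$, with all pairwise inner products (including squared norms) in $[0,1]$. Let $F=\sum_i\pi(i)\sum_j\pi_i(j)\,\delta_{\xi^{(2)}_i(:,j)}$. For every $n$ let $(X,A)\sim\mathrm{RDPG}(F)$ on $n$ vertices: the rows $X_1,\dots,X_n$ of $X$ are i.i.d. with law $F$, and given $X$ the symmetric hollow matrix $A\in\{0,1\}^{n\times n}$ has conditional law $\mathbb{P}[A\mid X]=\prod_{u>v}(X_u^\top X_v)^{A_{uv}}(1-X_u^\top X_v)^{1-A_{uv}}$. Let $V(H_i)$ be the set of vertices $v$ whose latent position $X_v$ is one of $\xi^{(2)}_i(:,1),\dots,\xi^{(2)}_i(:,K_i)$. **Assumptions.** 1. (Affinity) $p<q$,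 where $q=\min_{i,l,h}\langle\xi^{(2)}_i(:,l),\xi^{(2)}_i(:,h)\rangle$ and $p=\max_{i\ne j}\max_{l,h}\langle\xi^{(2)}_i(:,l),\xi^{(2)}_j(:,h)\rangle$ (in particular $R\ge2$). 2. (Subspace structure) $\xi=Z+\mathcal{A}$ with $Z$ block diagonal with blocks of size $K_i\times d_i$ and $Z\circ\mathcal{A}=0$ (Hadamard product), the off-block-diagonal entries of $\xi\xi^\top$ being at most $p$. 3. The second moment matrix $\Delta=\mathbb{E}[X_1X_1^\top]$ has rank $D$. **Embedding.** Let $\widehat X\in\mathbb{R}^{n\times D}$ be an adjacency spectral embedding of $A$: $\widehat X=U_AS_A^{1/2}$, where $S_A$ is the diagonal matrix of the $D$ largest eigenvalues of $|A|=(A^\top A)^{1/2}$ in decreasing order and $U_A$ has corresponding orthonormal eigenvectors as columns. **Seed selection.** Let $\mathcal{S}_0$ consist of $R$ rows of $\widehat X$ with distinct indices, chosen at random in any way. The seed sets are collections of $R$ rows of $\widehat X$, counted with multiplicity. For $i=1,\dots,n$ choose two different members $\tilde y,\tilde z$ of the collection $\mathcal{S}_{i-1}$ that maximize $\langle y,z\rangle$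 over all pairs of different members (a row that occurs twice gives two different members). If $\max_{x\in\mathcal{S}_{i-1}}\langle\widehat X(i,:),x\rangle<\langle\tilde y,\tilde z\rangle$, obtain $\mathcal{S}_i$ from $\mathcal{S}_{i-1}$ by replacing $\tilde z$ by $\widehat X(i,:)$; if this maximum is $>\langle\tilde y,\tilde z\rangle$, put $\mathcal{S}_i=\mathcal{S}_{i-1}$; in case of equality either is allowed. **Claim.** Let $E_n$ be the event that, whatever admissible choices are made (of the embedding, of the maximizing pairs and of which of the two members is replaced, and in case of equality), the final collection $\mathcal{S}_n$ satisfies $$\left|\mathcal{S}_n\cap\{\widehat X(v,:):v\in V(H_i)\}\right|=1\qquad\text{for all } i\in[R],$$ and moreover exactly one of the $R$ members of $\mathcal{S}_n$, counted with multiplicity, is the row of a vertex of $H_i$, for every $i\in[R]$. Then $E_n$ occurs asymptotically almost surely, that is: for every $c>0$ there is $n_0(c)$ such that $\mathbb{P}(E_n)\ge1-\eta$ whenever $n>n_0(c)$ and $n^{-c}<\eta<1/2$. -/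

import Mathlib

open scoped Matrix

noncomputable section

/-- The likelihood of the graph `G` given the latent positions `x`:
`∏_{i > j} (x_i ⬝ x_j)^{G_ij} (1 - x_i ⬝ x_j)^{1 - G_ij}`. -/
def edgeLikelihood {ι : Type*} [Fintype ι] {n : ℕ} (x : Fin n → ι → ℝ)
    (G : SimpleGraph (Fin n)) : ℝ :=
  open scoped Classical in
  ∏ i, ∏ j ∈ Finset.Iio i, if G.Adj i j then x i ⬝ᵥ x j else 1 - x i ⬝ᵥ x j

/-- `(X, A)` is an instance on `n` vertices of the random dot product graph with latent position
distribution `F`: the rows of `X` are i.i.d. with law `F`, and the conditional law of `A`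
given `X` has density `edgeLikelihood X`.  A symmetric hollow `0`-`1` matrix is encoded as a
simple graph. -/
structure IsRDPG {Ω ι : Type*} [MeasurableSpace Ω] [Fintype ι] {n : ℕ}
    (μ : MeasureTheory.Measure Ω) (F : MeasureTheory.Measure (ι → ℝ))
    (X : Ω → Fin n → ι → ℝ) (A : Ω → SimpleGraph (Fin n)) : Prop where
  measurable_latent : Measurable X
  measurableSet_graph : ∀ G, MeasurableSet {ω | A ω = G}
  map_latent : μ.map X = MeasureTheory.Measure.pi fun _ => F
  cond_graph : ∀ (G : SimpleGraph (Fin n)) (B : Set (Fin n → ι → ℝ)), MeasurableSet B →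
    μ ({ω | A ω = G} ∩ X ⁻¹' B) = ∫⁻ ω in X ⁻¹' B, ENNReal.ofReal (edgeLikelihood (X ω) G) ∂μ

/-- The second moment matrix `𝔼[x xᵀ]` of a distribution. -/
def secondMoment {ι : Type*} (F : MeasureTheory.Measure (ι → ℝ)) : Matrix ι ι ℝ :=
  Matrix.of fun a b => ∫ x, x a * x b ∂F

/-- Parameters of a 2-level hierarchical stochastic blockmodel with `R` subgraphs.  Subgraph `i`
has `K i` blocks, and the latent positions live in dimension `D = ∑ i, d i`, with
coordinates indexed by `Σ i, Fin (d i)`.  The row `ξ ⟨i, j⟩` is the latent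
position of block `j` of subgraph `i`. -/
structure HSBM (R : ℕ) (K d : Fin R → ℕ) where
  weight : Fin R → ℝ
  weight_pos : ∀ i, 0 < weight i
  weight_sum : ∑ i, weight i = 1
  blockWeight : ∀ i, Fin (K i) → ℝ
  blockWeight_pos : ∀ i j, 0 < blockWeight i j
  blockWeight_sum : ∀ i, ∑ j, blockWeight i j = 1
  ξ : Matrix (Σ i, Fin (K i)) (Σ i, Fin (d i)) ℝ
  distinct : Function.Injective ξ
  inner_mem : ∀ a b, ξ a ⬝ᵥ ξ b ∈ Set.Icc (0 : ℝ) 1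

namespace HSBM

variable {R : ℕ} {K d : Fin R → ℕ}

/-- The distribution `F_i = ∑_j π_i(j) δ_{ξ_i(j)}` of the latent positions in subgraph `i`. -/
def subgraphDistribution (P : HSBM R K d) (i : Fin R) :
    MeasureTheory.Measure ((Σ i, Fin (d i)) → ℝ) :=
  ∑ j, ENNReal.ofReal (P.blockWeight i j) • MeasureTheory.Measure.dirac (P.ξ ⟨i, j⟩)

/-- The latent position distribution `F = ∑_i π(i) F_i`. -/
def distribution (P : HSBM R K d) : MeasureTheory.Measure ((Σ i, Fin (d i)) → ℝ) :=
  ∑ i, ENNReal.ofReal (P.weight i) • P.subgraphDistribution i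

/-- Affinity: `q` is the least inner product within a subgraph, `p` the greatest one
between different subgraphs, and `p < q`. -/
structure Affinity (P : HSBM R K d) (p q : ℝ) : Prop where
  within : IsLeast {t | ∃ i l h, t = P.ξ ⟨i, l⟩ ⬝ᵥ P.ξ ⟨i, h⟩} q
  between : IsGreatest {t | ∃ i j, i ≠ j ∧ ∃ l h, t = P.ξ ⟨i, l⟩ ⬝ᵥ P.ξ ⟨j, h⟩} p
  lt : p < q

/-- Subspace structure: `ξ = Z + 𝒜` with `Z` block diagonal with blocks of size `K i × d i`,
`Z ⊙ 𝒜 = 0`, and the entries of `ξ ξᵀ` off the diagonal blocks bounded by `p`. -/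
def SubspaceStructure (P : HSBM R K d) (p : ℝ) : Prop :=
  ∃ (ζ : ∀ i, Matrix (Fin (K i)) (Fin (d i)) ℝ)
    (𝒜 : Matrix (Σ i, Fin (K i)) (Σ i, Fin (d i)) ℝ),
    P.ξ = Matrix.blockDiagonal' ζ + 𝒜 ∧ Matrix.blockDiagonal' ζ ⊙ 𝒜 = 0 ∧
    ∀ a b, a.1 ≠ b.1 → (P.ξ * P.ξᵀ) a b ≤ p

/-- The vertices of the `i`-th true subgraph: those whose latent position is a row of the `i`-th
block of `ξ`. -/
def subgraph (P : HSBM R K d) {n : ℕ} (x : Fin n → (Σ i, Fin (d i)) → ℝ) (i : Fin R) :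
    Set (Fin n) :=
  {v | ∃ j, x v = P.ξ ⟨i, j⟩}

end HSBM

/-- `Xhat` is an adjacency spectral embedding of `A` into `ℝ^D`: with
`|A| = (Aᵀ A)^{1/2} = U diag(s) Uᵀ` a spectral decomposition with decreasingly ordered
eigenvalues, the `k`-th column of `Xhat` is `√(s k)` times the `k`-th column of `U`, `k < D`. -/
def IsASE {n D : ℕ} (A : Matrix (Fin n) (Fin n) ℝ) (Xhat : Matrix (Fin n) (Fin D) ℝ) : Prop :=
  ∃ absA : Matrix (Fin n) (Fin n) ℝ, absA.PosSemidef ∧ absA * absA = Aᵀ * A ∧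
  ∃ U ∈ Matrix.orthogonalGroup (Fin n) ℝ, ∃ s : Fin n → ℝ, Antitone s ∧
    absA = U * Matrix.diagonal s * Uᵀ ∧
    ∃ h : D ≤ n, ∀ v k, Xhat v k = U v (Fin.castLE h k) * √(s (Fin.castLE h k))

/-- One step of the seed selection, processing the row `i`.  The seeds form a multiset of
row indices, so `{y, z} ≤ S` says that `y`, `z` are two different members of `S`.
A pair `y, z` of seeds with maximal inner product `c` is chosen; the row `i` replaces `z` if
`max_{w ∈ S} ⟨x i, x w⟩ ≤ c`, and `S` is kept if this maximum is `≥ c` (in case of equality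
both are allowed). -/
def SeedStep {n D : ℕ} (x : Matrix (Fin n) (Fin D) ℝ) (i : Fin n)
    (S S' : Multiset (Fin n)) : Prop :=
  ∃ y z, {y, z} ≤ S ∧ (∀ y' z', {y', z'} ≤ S → x y' ⬝ᵥ x z' ≤ x y ⬝ᵥ x z) ∧
    (((∀ w ∈ S, x i ⬝ᵥ x w ≤ x y ⬝ᵥ x z) ∧ S' = i ::ₘ S.erase z) ∨
      ((∃ w ∈ S, x y ⬝ᵥ x z ≤ x i ⬝ᵥ x w) ∧ S' = S))

/-- `Sn` is a possible final seed set when the rows of `x` are processed in order,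
starting from the initial seed set `S₀`. -/
def IsFinalSeedSet {n D : ℕ} (x : Matrix (Fin n) (Fin D) ℝ) (S₀ : Finset (Fin n))
    (Sn : Multiset (Fin n)) : Prop :=
  ∃ S : Fin (n + 1) → Multiset (Fin n), S 0 = S₀.val ∧
    (∀ i : Fin n, SeedStep x i (S i.castSucc) (S i.succ)) ∧ S (Fin.last n) = Sn

/-- The seeds `S` contain exactly one embedded row from the vertex set `V`, both counted as
seeds (with multiplicity) and as points of `ℝ^D`. -/
def HasExactlyOne {n D : ℕ} (x : Matrix (Fin n) (Fin D) ℝ) (S : Multiset (Fin n))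
    (V : Set (Fin n)) : Prop :=
  open scoped Classical in
  S.countP (· ∈ V) = 1 ∧ ((x '' {v | v ∈ S}) ∩ (x '' V)).ncard = 1

/-- The events `E n` occur asymptotically almost surely: for every `c > 0` there is `n₀` such
that the probability of `E n` is at least `1 - η` whenever `n > n₀` and `n ^ (-c) < η < 1/2`. -/
def OccursAAS {Ω : ℕ → Type*} [∀ n, MeasurableSpace (Ω n)]
    (μ : ∀ n, MeasureTheory.Measure (Ω n)) (E : ∀ n, Set (Ω n)) : Prop :=
  ∀ c : ℝ, 0 < c → ∃ n₀ : ℕ, ∀ n : ℕ, n₀ < n → ∀ η : ℝ, (n : ℝ) ^ (-c) < η → η < 1 / 2 →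
    1 - η ≤ (μ n).real (E n)

end

/-! Everything reduces to one uniform estimate: off an event of exponentially small probability, the
inner product of embedded rows `u`, `v` is within `(q - p) / 2` of `⟨X_u, X_v⟩`, for all `u`, `v` at
once, `u = v` included. Affinity then makes `t = (p + q) / 2` a strict threshold: inner products
within a subgraph exceed `t`, those between subgraphs stay below it.

Such a threshold decides the seed selection whatever choices are made. If the largest inner product
among `R` seeds is at most `t`, no two seeds share a subgraph, so by pigeonhole all `R` subgraphs
are represented. Hence a step never loses a represented subgraph and always leaves that of the
processed row represented (`SeedStep.class_represented`). After all rows have been processed, `R`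
seeds represent `R` subgraphs, once each; the initial seeds play no role.

For the estimate put `P = X Xᵀ` and `E = A - P`. The Gram matrix of the embedding is `A H A`, where
`H` inverts `A` on its `D` leading eigenvectors; compare `H` with the pseudoinverse `G = X (Xᵀ X)⁻²
Xᵀ` of `P`. The nonzero eigenvalues of `P` are at least of order `n` and `‖E‖` is a small multiple
of `n`, so `‖H - G‖` is a small multiple of `1 / n` (`l2_opNorm_pinv_sub_le`). Rows of `A` have norm
at most `√n`, so `A H A` and `A G A` are entrywise close. Moreover `A G A` is the Gram matrix of the
least-squares vectors `(Xᵀ X)⁻¹ Xᵀ A_w = X_w + (Xᵀ X)⁻¹ Xᵀ E_w`, whose error is small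
(`IsASE.abs_dotProduct_sub_le`). A spectral bound thus yields an entrywise one, with no alignment of
eigenvectors.

The bounds on `E` come from Hoeffding's inequality for the coordinates of `Xᵀ E_u` and the
off-diagonal entries of `E²`, with a union bound over polynomially many events. Full rank of the
second moment matrix and linear block sizes give the lower bound on the spectrum of `P`. -/

/-! ### Seed selection under a separating threshold -/

theorem Multiset.exists_pair_le_of_not_nodup_map {α β : Type*} [DecidableEq β] (f : α → β)
    (S : Multiset α) (h : ¬(S.map f).Nodup) : ∃ y z, {y, z} ≤ S ∧ f y = f z := by
  induction S using Multiset.induction with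
  | empty => simp at h
  | cons a S ih =>
    by_cases ha : f a ∈ S.map f
    · obtain ⟨b, hb, hab⟩ := Multiset.mem_map.1 ha
      exact ⟨a, b, Multiset.cons_le_cons a (Multiset.singleton_le.2 hb), hab.symm⟩
    · obtain ⟨y, z, hle, hyz⟩ := ih fun hS => h (by simpa using ⟨by simpa using ha, hS⟩)
      exact ⟨y, z, hle.trans (Multiset.le_cons_self S a), hyz⟩

theorem Multiset.exists_mem_eq_of_nodup_map {α : Type*} {R : ℕ} {f : α → Fin R} {S : Multiset α}
    (hcard : S.card = R) (h : (S.map f).Nodup) (i : Fin R) : ∃ w ∈ S, f w = i := by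
  have hu : (⟨S.map f, h⟩ : Finset (Fin R)) = Finset.univ := by
    rw [← Finset.card_eq_iff_eq_univ]
    simp [hcard]
  have hi : i ∈ (⟨S.map f, h⟩ : Finset (Fin R)) := hu ▸ Finset.mem_univ i
  simpa using hi

section Seeds

variable {n D R : ℕ} {x : Matrix (Fin n) (Fin D) ℝ} {cls : Fin n → Fin R} {t : ℝ}

theorem SeedStep.card_eq {i : Fin n} {S S' : Multiset (Fin n)} (h : SeedStep x i S S') :
    S'.card = S.card := by
  obtain ⟨y, z, hle, -, ⟨-, rfl⟩ | ⟨-, rfl⟩⟩ := h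
  · have hz : z ∈ S := Multiset.mem_of_le hle (by simp)
    rw [Multiset.card_cons, Multiset.card_erase_add_one hz]
  · rfl

/-- A step of the seed selection keeps every represented class and represents the class of the
row processed, provided that a threshold separates inner products within and between classes. -/
theorem SeedStep.class_represented (hsame : ∀ u v, cls u = cls v → t < x u ⬝ᵥ x v)
    (hdiff : ∀ u v, cls u ≠ cls v → x u ⬝ᵥ x v < t) {i : Fin n} {S S' : Multiset (Fin n)}
    (hcard : S.card = R) (h : SeedStep x i S S') :
    (∀ w ∈ S, ∃ w' ∈ S', cls w' = cls w) ∧ ∃ w' ∈ S', cls w' = cls i := by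
  obtain ⟨y, z, hle, hmax, hcase⟩ := h
  -- Pigeonhole: two seeds of one class would have inner product above `t`, hence above the maximum;
  -- so the `R` seeds have `R` distinct classes and exhaust them.
  have hall : x y ⬝ᵥ x z ≤ t → ∃ w ∈ S, cls w = cls i := by
    intro hc
    refine Multiset.exists_mem_eq_of_nodup_map hcard ?_ _
    by_contra hnd
    obtain ⟨y', z', hle', hyz'⟩ := Multiset.exists_pair_le_of_not_nodup_map cls S hnd
    have := hmax y' z' hle'
    have := hsame _ _ hyz'
    linarith
  rcases hcase with ⟨hw, rfl⟩ | ⟨⟨w, hwS, hw⟩, rfl⟩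
  · refine ⟨fun w hwS => ?_, i, by simp, rfl⟩
    by_cases hwz : w = z
    · subst hwz
      -- `{y, z} ≤ S` counts multiplicity, so `y` survives the removal of `z` even when both are the
      -- same row.
      have hy : y ∈ S.erase w := by
        rw [Multiset.insert_eq_cons, ← Multiset.singleton_add, add_comm,
          Multiset.singleton_add] at hle
        have := Multiset.erase_le_erase w hle
        rw [Multiset.erase_cons_head] at this
        exact Multiset.mem_of_le this (by simp)
      by_cases hyc : cls y = cls w
      · exact ⟨y, Multiset.mem_cons_of_mem hy, hyc⟩
      -- If `y` and the removed seed differ in class, the maximum is below `t` and some seed shares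
      -- the class of `i`; its inner product with row `i` exceeds `t`, which rules out a
      -- replacement.
      · obtain ⟨w', hw'S, hw'⟩ := hall (hdiff _ _ hyc).le
        have h1 := hw w' hw'S
        have h2 := hsame _ _ hw'.symm
        have h3 := hdiff _ _ hyc
        linarith
    · exact ⟨w, Multiset.mem_cons_of_mem ((Multiset.mem_erase_of_ne hwz).2 hwS), rfl⟩
  · refine ⟨fun w hw => ⟨w, hw, rfl⟩, ?_⟩
    by_cases hwi : cls i = cls w
    · exact ⟨w, hwS, hwi.symm⟩
    · exact hall (hw.trans (hdiff _ _ hwi).le)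

theorem IsFinalSeedSet.map_class_eq (hsame : ∀ u v, cls u = cls v → t < x u ⬝ᵥ x v)
    (hdiff : ∀ u v, cls u ≠ cls v → x u ⬝ᵥ x v < t) (hsurj : Function.Surjective cls)
    {S₀ : Finset (Fin n)} (hcard : S₀.card = R) {Sn : Multiset (Fin n)}
    (h : IsFinalSeedSet x S₀ Sn) : Sn.map cls = Finset.univ.val := by
  obtain ⟨S, h0, hstep, rfl⟩ := h
  have hc : ∀ k, (S k).card = R := by
    intro k
    induction k using Fin.induction with
    | zero => rw [h0]; exact hcard
    | succ k ih => rw [(hstep k).card_eq, ih]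
  have hrep : ∀ k : Fin (n + 1), ∀ v : Fin n, v.castSucc < k → ∃ w ∈ S k, cls w = cls v := by
    intro k
    induction k using Fin.induction with
    | zero => intro v hv; exact absurd hv (Fin.not_lt_zero _)
    | succ k ih =>
      intro v hv
      obtain ⟨h1, h2⟩ := (hstep k).class_represented hsame hdiff (hc _)
      rcases (Fin.castSucc_lt_succ_iff.1 hv).lt_or_eq with hlt | rfl
      · obtain ⟨w, hw, hwv⟩ := ih v (by simpa using hlt)
        obtain ⟨w', hw', hww'⟩ := h1 w hw
        exact ⟨w', hw', hww'.trans hwv⟩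
      · exact h2
  symm
  -- All `R` classes occur among `R` seeds, so each occurs exactly once.
  refine Multiset.eq_of_le_of_card_le ?_ (by simp [hc])
  refine (Multiset.le_iff_subset Finset.univ.nodup).2 fun i _ => ?_
  obtain ⟨v, rfl⟩ := hsurj i
  obtain ⟨w, hw, hwv⟩ := hrep (Fin.last n) v (Fin.castSucc_lt_last v)
  exact Multiset.mem_map.2 ⟨w, hw, hwv⟩

theorem IsFinalSeedSet.hasExactlyOne (hsame : ∀ u v, cls u = cls v → t < x u ⬝ᵥ x v)
    (hdiff : ∀ u v, cls u ≠ cls v → x u ⬝ᵥ x v < t) (hsurj : Function.Surjective cls)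
    {S₀ : Finset (Fin n)} (hcard : S₀.card = R) {Sn : Multiset (Fin n)}
    (h : IsFinalSeedSet x S₀ Sn) (i : Fin R) : HasExactlyOne x Sn {v | cls v = i} := by
  classical
  have hmap := h.map_class_eq hsame hdiff hsurj hcard
  have hcount : Sn.countP (cls · = i) = 1 := by
    have h1 : (Sn.map cls).count i = 1 := by
      rw [hmap]; exact Multiset.count_eq_one_of_mem Finset.univ.nodup (Finset.mem_univ i)
    rw [Multiset.count_map] at h1
    rw [Multiset.countP_eq_card_filter, ← h1]
    congr 1
    exact Multiset.filter_congr fun _ _ => eq_comm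
  obtain ⟨s, hs⟩ := Multiset.card_eq_one.1 ((Multiset.countP_eq_card_filter _ _).symm.trans hcount)
  have hmem : ∀ w, (w ∈ Sn ∧ cls w = i) ↔ w = s := fun w => by
    rw [← Multiset.mem_filter (p := fun w => cls w = i), hs, Multiset.mem_singleton]
  refine ⟨(by simpa [Multiset.countP_eq_card_filter] using hcount), Set.ncard_eq_one.2 ⟨x s, ?_⟩⟩
  have hsm := (hmem s).2 rfl
  ext a
  simp only [Set.mem_inter_iff, Set.mem_singleton_iff]
  constructor
  · rintro ⟨⟨w, hw, rfl⟩, v, hv, hvw⟩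
    -- Vertices of different classes cannot share an embedded point: its squared norm would lie both
    -- above and below `t`.
    have hwv : cls w = cls v := by
      by_contra hne
      have h1 := hdiff w v hne
      have h2 := hsame v v rfl
      rw [hvw] at h1 h2
      exact lt_asymm h1 h2
    rw [(hmem w).1 ⟨hw, hwv.trans hv⟩]
  · rintro rfl
    exact ⟨⟨s, hsm.1, rfl⟩, s, hsm.2, rfl⟩

end Seeds

/-! ### Euclidean and spectral norm estimates -/

section Gram

open scoped Matrix.Norms.L2Operator

open Matrix

variable {ν ι : Type*} [Fintype ν] [Fintype ι]

theorem norm_toLp_sq_eq_dotProduct (y : ν → ℝ) : ‖WithLp.toLp 2 y‖ ^ 2 = y ⬝ᵥ y := by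
  rw [EuclideanSpace.norm_sq_eq]
  simp [dotProduct, sq]

theorem norm_toLp_le_of_dotProduct_le {y : ν → ℝ} {r : ℝ} (hr : 0 ≤ r) (h : y ⬝ᵥ y ≤ r ^ 2) :
    ‖WithLp.toLp 2 y‖ ≤ r := by
  rw [← norm_toLp_sq_eq_dotProduct] at h
  exact (sq_le_sq₀ (norm_nonneg _) hr).1 h

theorem abs_dotProduct_le_norm_mul_norm (a b : ν → ℝ) :
    |a ⬝ᵥ b| ≤ ‖WithLp.toLp 2 a‖ * ‖WithLp.toLp 2 b‖ := by
  have := abs_real_inner_le_norm (WithLp.toLp 2 b) (WithLp.toLp 2 a)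
  rwa [EuclideanSpace.inner_eq_star_dotProduct, star_trivial, mul_comm] at this

theorem dotProduct_sq_le (a b : ν → ℝ) : (a ⬝ᵥ b) ^ 2 ≤ (a ⬝ᵥ a) * (b ⬝ᵥ b) := by
  rw [← norm_toLp_sq_eq_dotProduct, ← norm_toLp_sq_eq_dotProduct, ← mul_pow, ← sq_abs]
  exact pow_le_pow_left₀ (abs_nonneg _) (abs_dotProduct_le_norm_mul_norm a b) 2

theorem l2_opNorm_le_of_dotProduct_le [DecidableEq ι] {B : Matrix ν ι ℝ} {r : ℝ} (hr : 0 ≤ r)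
    (h : ∀ y, (B *ᵥ y) ⬝ᵥ (B *ᵥ y) ≤ r ^ 2 * (y ⬝ᵥ y)) : ‖B‖ ≤ r := by
  rw [Matrix.l2_opNorm_def]
  refine ContinuousLinearMap.opNorm_le_bound _ hr fun y => ?_
  have := h y.ofLp
  refine norm_toLp_le_of_dotProduct_le (by positivity) ?_
  rw [mul_pow, ← WithLp.toLp_ofLp 2 y, norm_toLp_sq_eq_dotProduct]
  exact this

theorem abs_dotProduct_mulVec_le [DecidableEq ι] (B : Matrix ν ι ℝ) (a : ν → ℝ) (b : ι → ℝ) :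
    |a ⬝ᵥ (B *ᵥ b)| ≤ ‖WithLp.toLp 2 a‖ * (‖B‖ * ‖WithLp.toLp 2 b‖) :=
  (abs_dotProduct_le_norm_mul_norm _ _).trans
    (mul_le_mul_of_nonneg_left (Matrix.l2_opNorm_mulVec B (WithLp.toLp 2 b)) (norm_nonneg _))

theorem l2_opNorm_transpose [DecidableEq ι] [DecidableEq ν] (B : Matrix ν ι ℝ) : ‖Bᵀ‖ = ‖B‖ := by
  rw [← Matrix.conjTranspose_eq_transpose_of_trivial, Matrix.l2_opNorm_conjTranspose]

theorem l2_opNorm_transpose_mul_self [DecidableEq ι] (B : Matrix ν ι ℝ) :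
    ‖Bᵀ * B‖ = ‖B‖ * ‖B‖ := by
  rw [← Matrix.conjTranspose_eq_transpose_of_trivial, Matrix.l2_opNorm_conjTranspose_mul_self]

/-- The identity `‖Qᵀ Q‖ = ‖Q‖²` turns idempotence into `‖Q‖ = ‖Q‖²`. -/
theorem l2_opNorm_le_one_of_idempotent [DecidableEq ν] {Q : Matrix ν ν ℝ} (hs : Qᵀ = Q)
    (hi : Q * Q = Q) : ‖Q‖ ≤ 1 := by
  have h := l2_opNorm_transpose_mul_self Q
  rw [hs, hi] at h
  nlinarith [norm_nonneg Q]

theorem l2_opNorm_conj_diagonal_le [DecidableEq ν] {U : Matrix ν ν ℝ} (hU : Uᵀ * U = 1)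
    {f : ν → ℝ} {r : ℝ} (hr : 0 ≤ r) (hf : ∀ k, |f k| ≤ r) :
    ‖U * diagonal f * Uᵀ‖ ≤ r := by
  have h1 : ‖U‖ ≤ 1 := by
    have h := l2_opNorm_transpose_mul_self U
    have h2 : ‖(1 : Matrix ν ν ℝ)‖ ≤ 1 := l2_opNorm_le_one_of_idempotent (by simp) (by simp)
    rw [hU] at h
    nlinarith [norm_nonneg U]
  have h3 : ‖(diagonal f : Matrix ν ν ℝ)‖ ≤ r := by
    rw [Matrix.l2_opNorm_diagonal, pi_norm_le_iff_of_nonneg hr]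
    exact hf
  calc ‖U * diagonal f * Uᵀ‖ ≤ ‖U‖ * ‖(diagonal f : Matrix ν ν ℝ)‖ * ‖Uᵀ‖ :=
        (Matrix.l2_opNorm_mul _ _).trans
          (mul_le_mul_of_nonneg_right (Matrix.l2_opNorm_mul _ _) (norm_nonneg _))
    _ ≤ 1 * r * 1 := by
        rw [l2_opNorm_transpose]
        gcongr
    _ = r := by ring

theorem conj_diagonal_mul [DecidableEq ν] {U : Matrix ν ν ℝ} (hU : Uᵀ * U = 1) (f g : ν → ℝ) :
    U * diagonal f * Uᵀ * (U * diagonal g * Uᵀ) = U * diagonal (fun k => f k * g k) * Uᵀ := by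
  rw [← Matrix.diagonal_mul_diagonal]
  calc U * diagonal f * Uᵀ * (U * diagonal g * Uᵀ)
      = U * diagonal f * (Uᵀ * U) * diagonal g * Uᵀ := by simp only [Matrix.mul_assoc]
    _ = _ := by rw [hU, Matrix.mul_one]; simp only [Matrix.mul_assoc]

theorem conj_diagonal_transpose [DecidableEq ν] (U : Matrix ν ν ℝ) (f : ν → ℝ) :
    (U * diagonal f * Uᵀ)ᵀ = U * diagonal f * Uᵀ := by
  simp [Matrix.mul_assoc]

/-- If `A * A` has eigenvalue `s k ^ 2` with `s k` large and `A` is bounded below by `-e`, then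
`s k` is an eigenvalue of `A`. -/
theorem mulVec_eq_of_sq_eq {A : Matrix ν ν ℝ} {e σ : ℝ} (hσ : e < σ)
    (hlow : ∀ y, -e * (y ⬝ᵥ y) ≤ y ⬝ᵥ (A *ᵥ y)) {u : ν → ℝ}
    (hu : A *ᵥ (A *ᵥ u) = σ ^ 2 • u) : A *ᵥ u = σ • u := by
  -- Since `(A - σ)(A + σ) u = 0`, the vector `y` satisfies `A y = -σ y`, and `-σ < -e` contradicts
  -- the lower bound on `A` unless `y = 0`.
  set y := A *ᵥ u - σ • u with hy
  have hAy : A *ᵥ y = (-σ) • y := by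
    rw [hy, Matrix.mulVec_sub, hu, Matrix.mulVec_smul, smul_sub, smul_smul]
    rw [neg_smul, sub_eq_add_neg, add_comm, neg_mul, neg_smul, sub_neg_eq_add, sq]
  have h := hlow y
  rw [hAy, dotProduct_smul, smul_eq_mul] at h
  have h0 : 0 ≤ y ⬝ᵥ y := by
    rw [← norm_toLp_sq_eq_dotProduct]; positivity
  have : y ⬝ᵥ y = 0 := by nlinarith
  exact sub_eq_zero.1 (dotProduct_self_eq_zero.1 this)

end Gram

/-! ### Singular values of a perturbed Gram matrix -/

section Gram

open scoped Matrix.Norms.L2Operator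

open Matrix

variable {ι : Type*} [Fintype ι] {n : ℕ}

theorem dotProduct_self_transpose_mulVec {ν : Type*} [Fintype ν] [DecidableEq ν]
    {U : Matrix ν ν ℝ} (hU : U * Uᵀ = 1) (y : ν → ℝ) : (Uᵀ *ᵥ y) ⬝ᵥ (Uᵀ *ᵥ y) = y ⬝ᵥ y := by
  rw [Matrix.dotProduct_mulVec, Matrix.vecMul_transpose, Matrix.mulVec_mulVec, hU,
    Matrix.one_mulVec]

theorem dotProduct_self_mulVec_of_sq_eq {ν : Type*} [Fintype ν] [DecidableEq ν]
    {A U : Matrix ν ν ℝ} {s : ν → ℝ} (hA : Aᵀ = A)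
    (hAA : A * A = U * diagonal (fun k => s k ^ 2) * Uᵀ) (y : ν → ℝ) :
    (A *ᵥ y) ⬝ᵥ (A *ᵥ y) = ∑ k, s k ^ 2 * (Uᵀ *ᵥ y) k ^ 2 := by
  have h1 : (A *ᵥ y) ⬝ᵥ (A *ᵥ y) = y ⬝ᵥ ((A * A) *ᵥ y) := by
    rw [← Matrix.mulVec_mulVec, Matrix.dotProduct_mulVec y, ← Matrix.mulVec_transpose, hA]
  rw [h1, hAA, ← Matrix.mulVec_mulVec, ← Matrix.mulVec_mulVec, Matrix.dotProduct_mulVec,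
    ← Matrix.mulVec_transpose, dotProduct]
  refine Finset.sum_congr rfl fun k _ => ?_
  rw [Matrix.mulVec_diagonal]
  ring

theorem dotProduct_self_nonneg {ν : Type*} [Fintype ν] (y : ν → ℝ) : 0 ≤ y ⬝ᵥ y := by
  rw [← norm_toLp_sq_eq_dotProduct]; positivity

theorem exists_ne_zero_mulVec_eq_zero {V W : Type*} [AddCommGroup V] [Module ℝ V]
    [FiniteDimensional ℝ V] [AddCommGroup W] [Module ℝ W] [FiniteDimensional ℝ W] (f : V →ₗ[ℝ] W)
    (h : Module.finrank ℝ W < Module.finrank ℝ V) : ∃ v, v ≠ 0 ∧ f v = 0 := by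
  obtain ⟨v, hv, hv0⟩ := (Submodule.ne_bot_iff _).1 (LinearMap.ker_ne_bot_of_finrank_lt h)
  exact ⟨v, hv0, hv⟩

section Weyl

variable {A U : Matrix (Fin n) (Fin n) ℝ} {s : Fin n → ℝ} {X : Matrix (Fin n) ι ℝ} {m e : ℝ}

theorem abs_dotProduct_mulVec_self_le {ν : Type*} [Fintype ν] {E : Matrix ν ν ℝ} (he : 0 ≤ e)
    (hE : ∀ y, (E *ᵥ y) ⬝ᵥ (E *ᵥ y) ≤ e ^ 2 * (y ⬝ᵥ y)) (y : ν → ℝ) :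
    |y ⬝ᵥ (E *ᵥ y)| ≤ e * (y ⬝ᵥ y) := by
  refine abs_le_of_sq_le_sq ?_ (mul_nonneg he (dotProduct_self_nonneg y))
  nlinarith [dotProduct_sq_le y (E *ᵥ y), hE y, dotProduct_self_nonneg y,
    mul_le_mul_of_nonneg_left (hE y) (dotProduct_self_nonneg y)]

/-- The leading singular values of a perturbation of `X * Xᵀ` are large. -/
theorem le_singularValue_of_lt_card (hA : Aᵀ = A) (hUU : U * Uᵀ = 1)
    (hs : Antitone s) (hs0 : ∀ k, 0 ≤ s k) (hAA : A * A = U * diagonal (fun k => s k ^ 2) * Uᵀ)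
    (hm : 0 < m) (he : 0 ≤ e) (hX : ∀ b, m * (b ⬝ᵥ b) ≤ (X *ᵥ b) ⬝ᵥ (X *ᵥ b))
    (hE : ∀ y, ((A - X * Xᵀ) *ᵥ y) ⬝ᵥ ((A - X * Xᵀ) *ᵥ y) ≤ e ^ 2 * (y ⬝ᵥ y))
    {k : Fin n} (hk : (k : ℕ) < Fintype.card ι) : m - e ≤ s k := by
  -- The range of `X` has dimension `card ι > k`, so it contains a nonzero vector orthogonal to the
  -- `k` leading singular vectors. On it `A` stretches by at most `s k`, while its quadratic form is
  -- at least `m - e` times the squared norm.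
  obtain ⟨b, hb0, hb⟩ := exists_ne_zero_mulVec_eq_zero
    ((LinearMap.funLeft ℝ ℝ (Subtype.val : {j : Fin n // j < k} → Fin n)) ∘ₗ
      (Uᵀ * X).mulVecLin) (by
        simp only [Module.finrank_fintype_fun_eq_card, Fintype.card_subtype]
        have h : (Finset.univ.filter fun j : Fin n => j < k).card = k := by
          rw [← Fin.card_Iio]; congr 1; ext; simp
        omega)
  set y := X *ᵥ b with hy
  have hz : ∀ j < k, (Uᵀ *ᵥ y) j = 0 := by
    intro j hj
    have h : ((Uᵀ * X) *ᵥ b) j = 0 := congrFun hb ⟨j, hj⟩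
    rwa [← Matrix.mulVec_mulVec] at h
  have hbb : 0 < b ⬝ᵥ b :=
    lt_of_le_of_ne (dotProduct_self_nonneg b) fun h => hb0 (dotProduct_self_eq_zero.1 h.symm)
  have hyy : 0 < y ⬝ᵥ y := lt_of_lt_of_le (mul_pos hm hbb) (hX b)
  have hAy : (A *ᵥ y) ⬝ᵥ (A *ᵥ y) ≤ s k ^ 2 * (y ⬝ᵥ y) := by
    rw [dotProduct_self_mulVec_of_sq_eq hA hAA, ← dotProduct_self_transpose_mulVec hUU y, dotProduct,
      Finset.mul_sum]
    refine Finset.sum_le_sum fun j _ => ?_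
    by_cases hj : j < k
    · simp [hz j hj]
    · rw [← sq]
      exact mul_le_mul_of_nonneg_right
        (pow_le_pow_left₀ (hs0 j) (hs (not_lt.1 hj)) 2) (sq_nonneg _)
  have hup : y ⬝ᵥ (A *ᵥ y) ≤ s k * (y ⬝ᵥ y) := by
    refine le_of_sq_le_sq ?_ (mul_nonneg (hs0 k) hyy.le)
    nlinarith [dotProduct_sq_le y (A *ᵥ y), mul_le_mul_of_nonneg_left hAy hyy.le]
  have hXX : y ⬝ᵥ ((X * Xᵀ) *ᵥ y) = (Xᵀ *ᵥ y) ⬝ᵥ (Xᵀ *ᵥ y) := by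
    rw [← Matrix.mulVec_mulVec, Matrix.dotProduct_mulVec, ← Matrix.mulVec_transpose]
  have hcs : y ⬝ᵥ y = b ⬝ᵥ (Xᵀ *ᵥ y) := by
    rw [hy, Matrix.mulVec_transpose, dotProduct_comm b, ← Matrix.dotProduct_mulVec]
  have hPy : m * (y ⬝ᵥ y) ≤ y ⬝ᵥ ((X * Xᵀ) *ᵥ y) := by
    rw [hXX]
    have h1 := dotProduct_sq_le b (Xᵀ *ᵥ y)
    rw [← hcs] at h1
    have h2 := hX b
    rw [← hy] at h2
    have h3 := dotProduct_self_nonneg (Xᵀ *ᵥ y)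
    have h4 : m * (y ⬝ᵥ y) ^ 2 ≤ (y ⬝ᵥ y) * ((Xᵀ *ᵥ y) ⬝ᵥ (Xᵀ *ᵥ y)) := by nlinarith
    nlinarith
  have hEy := (abs_le.1 (abs_dotProduct_mulVec_self_le he hE y)).1
  rw [Matrix.sub_mulVec, dotProduct_sub] at hEy
  nlinarith

/-- The remaining singular values of a perturbation of `X * Xᵀ` are small. -/
theorem singularValue_le_of_card_le (hA : Aᵀ = A) (hUU : U * Uᵀ = 1)
    (hs : Antitone s) (hs0 : ∀ k, 0 ≤ s k) (hAA : A * A = U * diagonal (fun k => s k ^ 2) * Uᵀ)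
    (he : 0 ≤ e)
    (hE : ∀ y, ((A - X * Xᵀ) *ᵥ y) ⬝ᵥ ((A - X * Xᵀ) *ᵥ y) ≤ e ^ 2 * (y ⬝ᵥ y))
    {k : Fin n} (hk : Fintype.card ι ≤ (k : ℕ)) : s k ≤ e := by
  -- There are `n - 1 - k` conditions from the columns after `k` and `card ι ≤ k` from `Xᵀ y = 0`,
  -- fewer than `n` in all. On such `y` the matrix `A` acts as the noise, yet stretches by at least
  -- `s k`.
  obtain ⟨y, hy0, hy⟩ := exists_ne_zero_mulVec_eq_zero
    (((LinearMap.funLeft ℝ ℝ (Subtype.val : {j : Fin n // k < j} → Fin n)) ∘ₗ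
      Uᵀ.mulVecLin).prod Xᵀ.mulVecLin) (by
        have := k.2
        simp only [Module.finrank_prod, Module.finrank_fintype_fun_eq_card, Fintype.card_fin,
          Fintype.card_subtype]
        have h : (Finset.univ.filter fun j : Fin n => k < j).card = n - 1 - k := by
          rw [← Fin.card_Ioi]; congr 1; ext; simp
        omega)
  have hy1 := congrArg Prod.fst hy
  have hy2 : Xᵀ *ᵥ y = 0 := congrArg Prod.snd hy
  have hz : ∀ j, k < j → (Uᵀ *ᵥ y) j = 0 := fun j hj => congrFun hy1 ⟨j, hj⟩
  have hyy : 0 < y ⬝ᵥ y :=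
    lt_of_le_of_ne (dotProduct_self_nonneg y) fun h => hy0 (dotProduct_self_eq_zero.1 h.symm)
  have hAy : s k ^ 2 * (y ⬝ᵥ y) ≤ (A *ᵥ y) ⬝ᵥ (A *ᵥ y) := by
    rw [dotProduct_self_mulVec_of_sq_eq hA hAA, ← dotProduct_self_transpose_mulVec hUU y, dotProduct,
      Finset.mul_sum]
    refine Finset.sum_le_sum fun j _ => ?_
    by_cases hj : k < j
    · simp [hz j hj]
    · rw [← sq]
      exact mul_le_mul_of_nonneg_right
        (pow_le_pow_left₀ (hs0 k) (hs (not_lt.1 hj)) 2) (sq_nonneg _)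
  have hEy := hE y
  rw [Matrix.sub_mulVec, ← Matrix.mulVec_mulVec, hy2, Matrix.mulVec_zero, sub_zero] at hEy
  exact le_of_sq_le_sq (le_of_mul_le_mul_right (hAy.trans hEy) hyy) he

end Weyl

end Gram

/-! ### Spectral form of the embedding and perturbation of pseudoinverses -/

section Gram

open scoped Matrix.Norms.L2Operator

open Matrix

variable {ι : Type*} [Fintype ι] {n : ℕ}

/-- The square roots in the embedding pair up in its Gram matrix, leaving the truncation of `|A|` to
its `D` leading eigenvalues. Only `A²`, not `A` itself, is diagonalised here, because `|A|` forgets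
the signs of the eigenvalues. -/
theorem IsASE.exists_spectral {D : ℕ} {A : Matrix (Fin n) (Fin n) ℝ}
    {Xhat : Matrix (Fin n) (Fin D) ℝ} (h : IsASE A Xhat) (hA : Aᵀ = A) :
    ∃ (U : Matrix (Fin n) (Fin n) ℝ) (s : Fin n → ℝ), U * Uᵀ = 1 ∧ Uᵀ * U = 1 ∧ Antitone s ∧
      (∀ k, 0 ≤ s k) ∧ A * A = U * diagonal (fun k => s k ^ 2) * Uᵀ ∧
      Xhat * Xhatᵀ = U * diagonal (fun k : Fin n => if (k : ℕ) < D then s k else 0) * Uᵀ := by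
  obtain ⟨B, hB, hBB, U, hU, s, hs, hBU, hDn, hX⟩ := h
  have hUU : U * Uᵀ = 1 := (Matrix.mem_orthogonalGroup_iff _ _).1 hU
  have hUU' : Uᵀ * U = 1 := (Matrix.mem_orthogonalGroup_iff' _ _).1 hU
  have hs0 : ∀ k, 0 ≤ s k := by
    have h1 : (Uᵀ * B * U).PosSemidef := by
      simpa using hB.conjTranspose_mul_mul_same U
    have h2 : Uᵀ * B * U = diagonal s := by
      calc Uᵀ * B * U = (Uᵀ * U) * diagonal s * (Uᵀ * U) := by
            rw [hBU]; simp only [Matrix.mul_assoc]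
        _ = _ := by simp [hUU']
    rw [h2] at h1
    exact Matrix.posSemidef_diagonal_iff.1 h1
  refine ⟨U, s, hUU, hUU', hs, hs0, ?_, ?_⟩
  · rw [← hA] 
    nth_rewrite 2 [hA]
    rw [← hBB, hBU, conj_diagonal_mul hUU']
    simp only [sq]
  · ext u v
    rw [Matrix.mul_apply, Matrix.mul_apply]
    simp only [Matrix.transpose_apply, Matrix.mul_diagonal]
    have h1 : ∀ k : Fin D, Xhat u k * Xhat v k =
        U u (Fin.castLE hDn k) * s (Fin.castLE hDn k) * U v (Fin.castLE hDn k) := by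
      intro k
      rw [hX, hX]
      calc _ = U u (Fin.castLE hDn k) * (√(s (Fin.castLE hDn k)) * √(s (Fin.castLE hDn k))) *
            U v (Fin.castLE hDn k) := by ring
        _ = _ := by rw [Real.mul_self_sqrt (hs0 _)]
    simp only [h1]
    rw [← Finset.sum_subset (Finset.subset_univ
      (Finset.univ.map (Fin.castLEEmb hDn))) (fun k _ hk => ?_)]
    · rw [Finset.sum_map]
      refine Finset.sum_congr rfl fun k _ => ?_
      simp
    · have : ¬((k : ℕ) < D) := fun hkD => hk (by
        simp only [Finset.mem_map, Finset.mem_univ, true_and]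
        exact ⟨⟨k, hkD⟩, by ext; simp⟩)
      simp [this]

variable {m e : ℝ}

theorem isUnit_det_of_coercive [DecidableEq ι] {X : Matrix (Fin n) ι ℝ} (hm : 0 < m)
    (hX : ∀ b, m * (b ⬝ᵥ b) ≤ (X *ᵥ b) ⬝ᵥ (X *ᵥ b)) : IsUnit (Xᵀ * X).det := by
  rw [← Matrix.isUnit_iff_isUnit_det, ← Matrix.mulVec_injective_iff_isUnit]
  rw [← Matrix.coe_mulVecLin, injective_iff_map_eq_zero]
  intro b hb
  have h1 : (X *ᵥ b) ⬝ᵥ (X *ᵥ b) = b ⬝ᵥ ((Xᵀ * X) *ᵥ b) := by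
    rw [← Matrix.mulVec_mulVec, Matrix.dotProduct_mulVec b, Matrix.vecMul_transpose]
  have h2 := hX b
  have h3 : (Xᵀ * X) *ᵥ b = 0 := hb
  rw [h1, h3, dotProduct_zero] at h2
  have h4 : b ⬝ᵥ b = 0 := by nlinarith [dotProduct_self_nonneg b]
  exact dotProduct_self_eq_zero.1 h4

/-- For `b = (Xᵀ X)⁻¹ y`, coercivity reads `m |b|² ≤ b · y`, and Cauchy–Schwarz gives `|b| ≤ |y| /
m`. -/
theorem l2_opNorm_inv_gram_le [DecidableEq ι] {X : Matrix (Fin n) ι ℝ} (hm : 0 < m)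
    (hX : ∀ b, m * (b ⬝ᵥ b) ≤ (X *ᵥ b) ⬝ᵥ (X *ᵥ b)) : ‖(Xᵀ * X)⁻¹‖ ≤ 1 / m := by
  refine l2_opNorm_le_of_dotProduct_le (by positivity) fun y => ?_
  set b := (Xᵀ * X)⁻¹ *ᵥ y with hb
  have hy : (Xᵀ * X) *ᵥ b = y := by
    rw [hb, Matrix.mulVec_mulVec, Matrix.mul_nonsing_inv _ (isUnit_det_of_coercive hm hX),
      Matrix.one_mulVec]
  have h1 : (X *ᵥ b) ⬝ᵥ (X *ᵥ b) = b ⬝ᵥ y := by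
    rw [← hy, ← Matrix.mulVec_mulVec, Matrix.dotProduct_mulVec b, Matrix.vecMul_transpose]
  have h2 := hX b
  rw [h1] at h2
  have h3 := dotProduct_sq_le b y
  have h0 := dotProduct_self_nonneg b
  rw [div_pow, one_pow, div_mul_eq_mul_div, one_mul, le_div_iff₀ (by positivity)]
  rcases h0.eq_or_lt with h | h
  · rw [← h, zero_mul]; exact dotProduct_self_nonneg y
  · have h4 : (m * (b ⬝ᵥ b)) ^ 2 ≤ (b ⬝ᵥ y) ^ 2 := pow_le_pow_left₀ (by positivity) h2 2
    nlinarith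

/-- Resolvent-type identity for the difference of two pseudoinverses, in norm. -/
theorem l2_opNorm_pinv_sub_le {ν : Type*} [Fintype ν] [DecidableEq ν]
    {A P H G S Q : Matrix ν ν ℝ}
    (hS : Sᵀ = S) (hSS : S * S = S) (hQ : Qᵀ = Q) (hQQ : Q * Q = Q)
    (hHA : H * A = S) (hHS : H * S = H) (hPG : P * G = Q) (hQG : Q * G = G)
    (hPQ : P * Q = P) {h g e : ℝ} (hH : ‖H‖ ≤ h) (hG : ‖G‖ ≤ g)
    (he : 0 ≤ e) (hE : ‖A - P‖ ≤ e) (hrest : ‖(1 - S) * A‖ ≤ e) :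
    ‖H - G‖ ≤ h * e * g + h * h * e + 2 * e * g * g := by
  have hh : 0 ≤ h := (norm_nonneg _).trans hH
  have hg : 0 ≤ g := (norm_nonneg _).trans hG
  have h1Q : ‖1 - Q‖ ≤ 1 := l2_opNorm_le_one_of_idempotent (by simp [hQ])
    (by simp [mul_sub, sub_mul, hQQ])
  have h1S : ‖1 - S‖ ≤ 1 := l2_opNorm_le_one_of_idempotent (by simp [hS])
    (by simp [mul_sub, sub_mul, hSS])
  -- This is the splitting `(H Q - S G) + (H - H Q) - (G - S G)`. In the middle term `P (1 - Q) = 0`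
  -- allows `A` to be replaced by `A - P`; in the last, `(1 - S) P` is written as a difference of
  -- two matrices of norm at most `e`.
  have key : H - G = -(H * (A - P) * G) + H * H * (A - P) * (1 - Q)
      - ((1 - S) * A - (1 - S) * (A - P)) * G * G := by
    have e1 : H * (A - P) * G = S * G - H * Q := by
      rw [mul_sub, sub_mul, hHA, mul_assoc, hPG]
    have e2 : H * H * (A - P) * (1 - Q) = H - H * Q := by
      have : (A - P) * (1 - Q) = A * (1 - Q) := by
        rw [sub_mul, mul_sub P, mul_one, hPQ, sub_self, sub_zero]
      rw [mul_assoc, this, mul_assoc, ← mul_assoc H A, hHA, ← mul_assoc, hHS, mul_sub, mul_one]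
    have e3 : ((1 - S) * A - (1 - S) * (A - P)) * G * G = G - S * G := by
      rw [← mul_sub, sub_sub_cancel, mul_assoc, mul_assoc, ← mul_assoc P, hPG, hQG, sub_mul,
        one_mul]
    rw [e1, e2, e3]
    abel
  have n1 : ‖H * (A - P) * G‖ ≤ h * e * g :=
    (norm_mul_le _ _).trans (mul_le_mul ((norm_mul_le _ _).trans
      (mul_le_mul hH hE (norm_nonneg _) hh)) hG (norm_nonneg _) (by positivity))
  have n2 : ‖H * H * (A - P) * (1 - Q)‖ ≤ h * h * e * 1 :=
    (norm_mul_le _ _).trans (mul_le_mul ((norm_mul_le _ _).trans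
      (mul_le_mul ((norm_mul_le _ _).trans (mul_le_mul hH hH (norm_nonneg _) hh)) hE
        (norm_nonneg _) (by positivity))) h1Q (norm_nonneg _) (by positivity))
  have n3 : ‖(1 - S) * A - (1 - S) * (A - P)‖ ≤ 2 * e := by
    have : ‖(1 - S) * (A - P)‖ ≤ 1 * e :=
      (norm_mul_le _ _).trans (mul_le_mul h1S hE (norm_nonneg _) zero_le_one)
    linarith [norm_sub_le ((1 - S) * A) ((1 - S) * (A - P))]
  have n4 : ‖((1 - S) * A - (1 - S) * (A - P)) * G * G‖ ≤ 2 * e * g * g :=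
    (norm_mul_le _ _).trans (mul_le_mul ((norm_mul_le _ _).trans
      (mul_le_mul n3 hG (norm_nonneg _) (by positivity))) hG (norm_nonneg _) (by positivity))
  rw [key]
  have t1 := norm_sub_le (-(H * (A - P) * G) + H * H * (A - P) * (1 - Q))
    (((1 - S) * A - (1 - S) * (A - P)) * G * G)
  have t2 := norm_add_le (-(H * (A - P) * G)) (H * H * (A - P) * (1 - Q))
  rw [norm_neg] at t2
  linarith

end Gram

/-! ### Entrywise consistency of the embedding -/

section Gram

open scoped Matrix.Norms.L2Operator

open Matrix

variable {ι : Type*} [Fintype ι] [DecidableEq ι] {n D : ℕ} {m e : ℝ}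
  {A : Matrix (Fin n) (Fin n) ℝ} {X : Matrix (Fin n) ι ℝ}

/-- A low-rank pseudoinverse of the adjacency matrix, built from the embedding, which is close to
the pseudoinverse of `X * Xᵀ`. -/
theorem IsASE.exists_pinv {Xhat : Matrix (Fin n) (Fin D) ℝ} (h : IsASE A Xhat) (hA : Aᵀ = A)
    (hD : D = Fintype.card ι) (hm : 0 < m) (he : 0 ≤ e) (hem : 4 * e ≤ m)
    (hX : ∀ b, m * (b ⬝ᵥ b) ≤ (X *ᵥ b) ⬝ᵥ (X *ᵥ b))
    (hE : ∀ y, ((A - X * Xᵀ) *ᵥ y) ⬝ᵥ ((A - X * Xᵀ) *ᵥ y) ≤ e ^ 2 * (y ⬝ᵥ y)) :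
    ∃ H : Matrix (Fin n) (Fin n) ℝ, A * H * A = Xhat * Xhatᵀ ∧
      ‖H - X * (Xᵀ * X)⁻¹ * ((Xᵀ * X)⁻¹ * Xᵀ)‖ ≤ 8 * e / m ^ 2 := by
  obtain ⟨U, s, hUU, hUU', hs, hs0, hAA, hXX⟩ := h.exists_spectral hA
  have hlarge : ∀ k : Fin n, (k : ℕ) < D → m / 2 < s k := fun k hk => by
    have := le_singularValue_of_lt_card hA hUU hs hs0 hAA hm he hX hE (hD ▸ hk)
    linarith
  have hsmall : ∀ k : Fin n, ¬((k : ℕ) < D) → s k ≤ e := fun k hk =>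
    singularValue_le_of_card_le hA hUU hs hs0 hAA he hE (hD ▸ not_lt.1 hk)
  -- `X Xᵀ` is positive semidefinite, so negative eigenvalues of `A` come from the noise alone. The
  -- `D` leading eigenvectors of `|A|`, with eigenvalues above `m / 2 > e`, therefore belong to
  -- positive eigenvalues of `A`.
  have hlow : ∀ y, -e * (y ⬝ᵥ y) ≤ y ⬝ᵥ (A *ᵥ y) := by
    intro y
    have h1 := (abs_le.1 (abs_dotProduct_mulVec_self_le he hE y)).1
    have h2 : y ⬝ᵥ ((X * Xᵀ) *ᵥ y) = (Xᵀ *ᵥ y) ⬝ᵥ (Xᵀ *ᵥ y) := by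
      rw [← Matrix.mulVec_mulVec, Matrix.dotProduct_mulVec, ← Matrix.mulVec_transpose]
    have h3 := dotProduct_self_nonneg (Xᵀ *ᵥ y)
    rw [Matrix.sub_mulVec, dotProduct_sub, h2] at h1
    linarith
  have hAAU : A * (A * U) = U * diagonal (fun k => s k ^ 2) := by
    rw [← Matrix.mul_assoc, hAA, Matrix.mul_assoc, hUU', Matrix.mul_one]
  have heig : ∀ k : Fin n, (k : ℕ) < D → ∀ v, (A * U) v k = s k * U v k := by
    intro k hk v
    have h1 : A *ᵥ U.col k = s k • U.col k := by
      refine mulVec_eq_of_sq_eq (e := e) (by linarith [hlarge k hk]) hlow ?_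
      ext w
      have := congrFun (congrFun hAAU w) k
      rw [Matrix.mul_diagonal] at this
      simp only [Pi.smul_apply, smul_eq_mul, Matrix.col_apply]
      rw [mul_comm, ← this, Matrix.mul_apply]
      rfl
    exact congrFun h1 v
  have hAU : ∀ f : Fin n → ℝ, A * (U * diagonal (fun k : Fin n => if (k : ℕ) < D then f k else 0)
      * Uᵀ) = U * diagonal (fun k : Fin n => if (k : ℕ) < D then s k * f k else 0) * Uᵀ := by
    intro f
    rw [← Matrix.mul_assoc, ← Matrix.mul_assoc]
    congr 1
    ext v k
    rw [Matrix.mul_diagonal, Matrix.mul_diagonal]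
    split_ifs with hk
    · rw [heig k hk]; ring
    · simp
  set H := U * diagonal (fun k : Fin n => if (k : ℕ) < D then (s k)⁻¹ else 0) * Uᵀ with hH
  set S := U * diagonal (fun k : Fin n => if (k : ℕ) < D then (1 : ℝ) else 0) * Uᵀ with hS
  have hHt : Hᵀ = H := conj_diagonal_transpose _ _
  have hSt : Sᵀ = S := conj_diagonal_transpose _ _
  have hAH : A * H = S := by
    rw [hH, hAU, hS]
    congr 3
    ext k
    split_ifs with hk
    · exact mul_inv_cancel₀ (by linarith [hlarge k hk])
    · rfl
  have hHA : H * A = S := by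
    rw [← hSt, ← hAH, Matrix.transpose_mul, hHt, hA]
  have hAS : A * S = Xhat * Xhatᵀ := by
    rw [hXX, hS, hAU fun _ => 1]
    simp only [mul_one]
  have hT := isUnit_det_of_coercive hm hX
  set T := (Xᵀ * X)⁻¹ with hTdef
  have hTt : Tᵀ = T := by
    rw [hTdef, Matrix.transpose_nonsing_inv]; simp
  have hTn : ‖T‖ ≤ 1 / m := l2_opNorm_inv_gram_le hm hX
  have hTX : T * (Xᵀ * X) = 1 := Matrix.nonsing_inv_mul _ hT
  have hXT : Xᵀ * X * T = 1 := Matrix.mul_nonsing_inv _ hT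
  refine ⟨H, by rw [Matrix.mul_assoc, hHA, hAS], ?_⟩
  have hHn : ‖H‖ ≤ 2 / m := by
    refine l2_opNorm_conj_diagonal_le hUU' (by positivity) fun k => ?_
    split_ifs with hk
    · have := hlarge k hk
      rw [abs_of_nonneg (inv_nonneg.2 (hs0 k))]
      calc (s k)⁻¹ ≤ (m / 2)⁻¹ := inv_anti₀ (by positivity) this.le
        _ = 2 / m := by rw [inv_div]
    · rw [abs_zero]; positivity
  have hGn : ‖X * T * (T * Xᵀ)‖ ≤ 1 / m := by
    have h1 : T * Xᵀ = (X * T)ᵀ := by rw [Matrix.transpose_mul, hTt]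
    -- `(X T)ᵀ (X T) = T (Xᵀ X) T = T`.
    have h2 : ‖X * T‖ * ‖X * T‖ = ‖T‖ := by
      rw [← l2_opNorm_transpose_mul_self, ← h1, Matrix.mul_assoc, ← Matrix.mul_assoc Xᵀ, hXT,
        Matrix.mul_one]
    calc ‖X * T * (T * Xᵀ)‖ ≤ ‖X * T‖ * ‖T * Xᵀ‖ := Matrix.l2_opNorm_mul _ _
      _ = ‖T‖ := by rw [h1, l2_opNorm_transpose, h2]
      _ ≤ 1 / m := hTn
  have hEn : ‖A - X * Xᵀ‖ ≤ e := l2_opNorm_le_of_dotProduct_le he hE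
  have h1S : 1 - S = U * diagonal (fun k : Fin n => if (k : ℕ) < D then (0 : ℝ) else 1) * Uᵀ := by
    rw [sub_eq_iff_eq_add, hS, ← Matrix.add_mul, ← Matrix.mul_add, Matrix.diagonal_add]
    have : (fun k : Fin n => (if (k : ℕ) < D then (0 : ℝ) else 1) + if (k : ℕ) < D then 1 else 0)
        = fun _ => 1 := by
      ext k; split_ifs <;> simp
    rw [this, Matrix.diagonal_one, Matrix.mul_one, hUU]
  have hrest : ‖(1 - S) * A‖ ≤ e := by
    -- The squared norm is that of `(1 - S) A² (1 - S)`, which is diagonal in `U` with entries `s k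
    -- ^ 2` for `k ≥ D` only.
    have h1 := l2_opNorm_transpose_mul_self (((1 - S) * A)ᵀ)
    rw [Matrix.transpose_transpose, l2_opNorm_transpose, Matrix.transpose_mul, hA,
      Matrix.transpose_sub, hSt, Matrix.transpose_one, Matrix.mul_assoc, ← Matrix.mul_assoc A,
      hAA, h1S, conj_diagonal_mul hUU', conj_diagonal_mul hUU'] at h1
    rw [← h1S] at h1
    have h2 : ‖(1 - S) * A‖ * ‖(1 - S) * A‖ ≤ e ^ 2 := by
      rw [← h1]
      refine l2_opNorm_conj_diagonal_le hUU' (by positivity) fun k => ?_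
      split_ifs with hk
      · simp; positivity
      · rw [one_mul, mul_one, abs_of_nonneg (sq_nonneg _)]
        exact pow_le_pow_left₀ (hs0 k) (hsmall k hk) 2
    rw [← sq] at h2
    exact le_of_sq_le_sq h2 he
  -- With `h = 2 / m` and `g = 1 / m` the three terms are `2e/m²`, `4e/m²` and `2e/m²`, whence the
  -- constant `8`.
  have hpinv := l2_opNorm_pinv_sub_le (A := A) (P := X * Xᵀ) (H := H) (G := X * T * (T * Xᵀ))
    (S := S) (Q := X * T * Xᵀ) (h := 2 / m) (g := 1 / m) (e := e) hSt
    (by rw [hS, conj_diagonal_mul hUU']; congr 3; ext k; split_ifs <;> simp)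
    (by rw [Matrix.transpose_mul, Matrix.transpose_mul, Matrix.transpose_transpose, hTt,
      Matrix.mul_assoc])
    (by
      calc X * T * Xᵀ * (X * T * Xᵀ) = X * (T * (Xᵀ * X)) * T * Xᵀ := by
            simp only [Matrix.mul_assoc]
        _ = _ := by rw [hTX, Matrix.mul_one])
    hHA
    (by rw [hH, hS, conj_diagonal_mul hUU']; congr 3; ext k; split_ifs <;> simp)
    (by
      calc X * Xᵀ * (X * T * (T * Xᵀ)) = X * (Xᵀ * X * T) * T * Xᵀ := by
            simp only [Matrix.mul_assoc]
        _ = _ := by rw [hXT, Matrix.mul_one])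
    (by
      calc X * T * Xᵀ * (X * T * (T * Xᵀ)) = X * (T * (Xᵀ * X)) * T * (T * Xᵀ) := by
            simp only [Matrix.mul_assoc]
        _ = _ := by rw [hTX, Matrix.mul_one])
    (by
      calc X * Xᵀ * (X * T * Xᵀ) = X * (Xᵀ * X * T) * Xᵀ := by simp only [Matrix.mul_assoc]
        _ = _ := by rw [hXT, Matrix.mul_one])
    hHn hGn he hEn hrest
  refine hpinv.trans (le_of_eq ?_)
  field_simp
  ring

/-- Entrywise consistency of the Gram matrix of the adjacency spectral embedding. -/
theorem IsASE.abs_dotProduct_sub_le {Xhat : Matrix (Fin n) (Fin D) ℝ} (h : IsASE A Xhat)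
    (hA : Aᵀ = A) (hD : D = Fintype.card ι) (hm : 0 < m) (he : 0 ≤ e) (hem : 4 * e ≤ m)
    (hX : ∀ b, m * (b ⬝ᵥ b) ≤ (X *ᵥ b) ⬝ᵥ (X *ᵥ b))
    (hE : ∀ y, ((A - X * Xᵀ) *ᵥ y) ⬝ᵥ ((A - X * Xᵀ) *ᵥ y) ≤ e ^ 2 * (y ⬝ᵥ y))
    (hXE : ∀ u, (Xᵀ *ᵥ (A - X * Xᵀ) u) ⬝ᵥ (Xᵀ *ᵥ (A - X * Xᵀ) u) ≤ e ^ 2)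
    (hX1 : ∀ u, X u ⬝ᵥ X u ≤ 1) {a : ℝ} (ha : 0 ≤ a) (hAa : ∀ u, A u ⬝ᵥ A u ≤ a ^ 2)
    (u v : Fin n) :
    |Xhat u ⬝ᵥ Xhat v - X u ⬝ᵥ X v| ≤ a ^ 2 * (8 * e / m ^ 2) + 3 * e / m := by
  obtain ⟨H, hH, hHG⟩ := h.exists_pinv hA hD hm he hem hX hE
  have hT := isUnit_det_of_coercive hm hX
  have hTn : ‖(Xᵀ * X)⁻¹‖ ≤ 1 / m := l2_opNorm_inv_gram_le hm hX
  have hTt : ((Xᵀ * X)⁻¹)ᵀ = (Xᵀ * X)⁻¹ := by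
    rw [Matrix.transpose_nonsing_inv]; simp
  have hTX : (Xᵀ * X)⁻¹ * (Xᵀ * X) = 1 := Matrix.nonsing_inv_mul _ hT
  set T := (Xᵀ * X)⁻¹
  set G := X * T * (T * Xᵀ) with hG
  have hrow : ∀ (B : Matrix (Fin n) (Fin n) ℝ), A u ⬝ᵥ (B *ᵥ A v) = (A * B * A) u v := by
    intro B
    rw [Matrix.mul_apply_eq_vecMul, Matrix.mul_apply_eq_vecMul, Matrix.dotProduct_mulVec]
    refine Finset.sum_congr rfl fun k _ => ?_
    have h1 : A k v = A v k := congrFun (congrFun hA v) k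
    exact congrArg ((A u ᵥ* B) k * ·) h1.symm
  have h1 : |(A * H * A) u v - (A * G * A) u v| ≤ a ^ 2 * (8 * e / m ^ 2) := by
    rw [← hrow, ← hrow, ← dotProduct_sub, ← Matrix.sub_mulVec]
    refine (abs_dotProduct_mulVec_le _ _ _).trans ?_
    calc _ ≤ a * ((8 * e / m ^ 2) * a) := by
          gcongr
          · exact norm_toLp_le_of_dotProduct_le ha (hAa u)
          · exact norm_toLp_le_of_dotProduct_le ha (hAa v)
      _ = _ := by ring
  -- Least squares: regressing the row `A w` on the columns of `X` recovers `X w` exactly, up to the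
  -- regression of the noise row.
  have hg : ∀ w, T *ᵥ (Xᵀ *ᵥ A w) = X w + T *ᵥ (Xᵀ *ᵥ (A - X * Xᵀ) w) := by
    intro w
    have h2 : A w = (A - X * Xᵀ) w + X *ᵥ X w := by
      ext k
      simp [Matrix.mul_apply, Matrix.mulVec, dotProduct, mul_comm]
    have h3 : T *ᵥ (Xᵀ *ᵥ (X *ᵥ X w)) = X w := by
      rw [Matrix.mulVec_mulVec, Matrix.mulVec_mulVec, Matrix.mul_assoc, hTX, Matrix.one_mulVec]
    conv_lhs => rw [h2]
    rw [Matrix.mulVec_add, Matrix.mulVec_add, h3, add_comm]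
  have h2 : (A * G * A) u v = (T *ᵥ (Xᵀ *ᵥ A u)) ⬝ᵥ (T *ᵥ (Xᵀ *ᵥ A v)) := by
    rw [← hrow, hG, ← Matrix.mulVec_mulVec, ← Matrix.mulVec_mulVec, ← Matrix.mulVec_mulVec,
      Matrix.dotProduct_mulVec, ← Matrix.mulVec_transpose, Matrix.dotProduct_mulVec,
      ← Matrix.mulVec_transpose, hTt]
  have hr : ∀ w, ‖WithLp.toLp 2 (T *ᵥ (Xᵀ *ᵥ (A - X * Xᵀ) w))‖ ≤ e / m := by
    intro w
    calc _ ≤ ‖T‖ * ‖WithLp.toLp 2 (Xᵀ *ᵥ (A - X * Xᵀ) w)‖ :=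
          Matrix.l2_opNorm_mulVec T (WithLp.toLp 2 _)
      _ ≤ 1 / m * e := by
          gcongr
          exact norm_toLp_le_of_dotProduct_le he (hXE w)
      _ = e / m := by ring
  have hx : ∀ w, ‖WithLp.toLp 2 (X w)‖ ≤ 1 := fun w =>
    norm_toLp_le_of_dotProduct_le zero_le_one (by simpa using hX1 w)
  have h3 : |(A * G * A) u v - X u ⬝ᵥ X v| ≤ 3 * e / m := by
    rw [h2, hg, hg]
    set r := fun w => T *ᵥ (Xᵀ *ᵥ (A - X * Xᵀ) w)
    have hem1 : e / m ≤ 1 := by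
      rw [div_le_one hm]; linarith
    have hem0 : 0 ≤ e / m := by positivity
    have t1 : |X u ⬝ᵥ r v| ≤ 1 * (e / m) := (abs_dotProduct_le_norm_mul_norm _ _).trans
      (mul_le_mul (hx u) (hr v) (norm_nonneg _) zero_le_one)
    have t2 : |r u ⬝ᵥ X v| ≤ (e / m) * 1 := (abs_dotProduct_le_norm_mul_norm _ _).trans
      (mul_le_mul (hr u) (hx v) (norm_nonneg _) hem0)
    have t3 : |r u ⬝ᵥ r v| ≤ (e / m) * (e / m) := (abs_dotProduct_le_norm_mul_norm _ _).trans
      (mul_le_mul (hr u) (hr v) (norm_nonneg _) hem0)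
    have t4 : (e / m) * (e / m) ≤ e / m := mul_le_of_le_one_left hem0 hem1
    have : (X u + r u) ⬝ᵥ (X v + r v) - X u ⬝ᵥ X v
        = X u ⬝ᵥ r v + r u ⬝ᵥ X v + r u ⬝ᵥ r v := by
      simp only [add_dotProduct, dotProduct_add]; ring
    change |(X u + r u) ⬝ᵥ (X v + r v) - X u ⬝ᵥ X v| ≤ _
    rw [this]
    have t5 := abs_add_le (X u ⬝ᵥ r v + r u ⬝ᵥ X v) (r u ⬝ᵥ r v)
    have t6 := abs_add_le (X u ⬝ᵥ r v) (r u ⬝ᵥ X v)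
    have : 3 * e / m = 3 * (e / m) := by ring
    linarith
  have h4 : Xhat u ⬝ᵥ Xhat v = (A * H * A) u v := by
    rw [hH]; rfl
  rw [h4]
  have h5 := abs_sub_le ((A * H * A) u v) ((A * G * A) u v) (X u ⬝ᵥ X v)
  linarith

end Gram

/-! ### Hoeffding's inequality and the graph as independent coin flips -/

section EdgeMeasure

open MeasureTheory ProbabilityTheory

theorem measureReal_abs_sum_ge_le {Ω κ : Type*} [MeasurableSpace Ω] [Fintype κ] {μ : Measure Ω}
    [IsProbabilityMeasure μ] {Y : κ → Ω → ℝ} (hind : iIndepFun Y μ) (hmeas : ∀ i, Measurable (Y i))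
    (hbdd : ∀ i ω, |Y i ω| ≤ 1) (hmean : ∀ i, ∫ ω, Y i ω ∂μ = 0) {n : ℕ}
    (hcard : Fintype.card κ ≤ n) {ε : ℝ} (hε : 0 < ε) (hn : 0 < n) :
    μ.real {ω | ε * n ≤ |∑ i, Y i ω|} ≤ 2 * Real.exp (-(ε ^ 2 / 2) * n) := by
  have hn' : (0 : ℝ) < n := Nat.cast_pos.2 hn
  rcases isEmpty_or_nonempty κ with hκ | hκ
  · have : {ω | ε * n ≤ |∑ i, Y i ω|} = ∅ := by
      refine Set.eq_empty_iff_forall_notMem.2 fun ω (hω : ε * n ≤ |∑ i, Y i ω|) => ?_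
      rw [Finset.univ_eq_empty, Finset.sum_empty, abs_zero] at hω
      exact absurd hω (not_le.2 (by positivity))
    rw [this, measureReal_empty]
    positivity
  have key : ∀ Z : κ → Ω → ℝ, iIndepFun Z μ → (∀ i, Measurable (Z i)) → (∀ i ω, |Z i ω| ≤ 1) →
      (∀ i, ∫ ω, Z i ω ∂μ = 0) →
      μ.real {ω | ε * n ≤ ∑ i, Z i ω} ≤ Real.exp (-(ε ^ 2 / 2) * n) := by
    intro Z h1 h2 h3 h4
    refine (HasSubgaussianMGF.measure_sum_ge_le_of_iIndepFun h1 (c := fun _ => 1) (fun i _ => ?_)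
      (by positivity)).trans ?_
    -- A centred variable in `[-1, 1]` has sub-Gaussian parameter `1`; with at most `n` summands the
    -- exponent is at most `-(ε n)² / (2 n)`.
    · have := hasSubgaussianMGF_of_mem_Icc_of_integral_eq_zero (μ := μ) (a := -1) (b := 1)
        (h2 i).aemeasurable (ae_of_all _ fun ω => abs_le.1 (h3 i ω)) (h4 i)
      convert this using 1
      ext
      norm_num
    · refine Real.exp_le_exp.2 ?_
      have hc : (0 : ℝ) < Fintype.card κ := Nat.cast_pos.2 Fintype.card_pos
      have hcn : (Fintype.card κ : ℝ) ≤ n := Nat.cast_le.2 hcard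
      simp only [Finset.sum_const, Finset.card_univ, nsmul_eq_mul, NNReal.coe_natCast, mul_one]
      rw [neg_div, neg_mul, neg_le_neg_iff, le_div_iff₀ (by positivity)]
      nlinarith [mul_le_mul_of_nonneg_left hcn (by positivity : 0 ≤ ε ^ 2 * n)]
  have h1 := key Y hind hmeas hbdd hmean
  have h2 := key (fun i ω => -Y i ω) (hind.comp (fun _ y => -y) fun _ => measurable_neg)
    (fun i => (hmeas i).neg) (fun i ω => by rw [abs_neg]; exact hbdd i ω)
    (fun i => by rw [integral_neg, hmean i, neg_zero])
  have h3 : {ω | ε * n ≤ |∑ i, Y i ω|} ⊆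
      {ω | ε * n ≤ ∑ i, Y i ω} ∪ {ω | ε * n ≤ ∑ i, -Y i ω} := by
    intro ω hω
    rcases le_abs.1 (show ε * n ≤ |∑ i, Y i ω| from hω) with h | h
    · exact Or.inl h
    · refine Or.inr ?_
      change ε * n ≤ ∑ i, -Y i ω
      rwa [Finset.sum_neg_distrib]
  calc _ ≤ _ := measureReal_mono h3
    _ ≤ _ := measureReal_union_le _ _
    _ ≤ _ := by linarith

/-- The law of a coin with success probability `p`. -/
noncomputable def coinMeasure (p : ℝ) : Measure Bool :=
  ENNReal.ofReal p • Measure.dirac true + ENNReal.ofReal (1 - p) • Measure.dirac false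

theorem coinMeasure_singleton (p : ℝ) (b : Bool) :
    coinMeasure p {b} = ENNReal.ofReal (if b then p else 1 - p) := by
  cases b <;> simp [coinMeasure]

instance (p : Set.Icc (0 : ℝ) 1) : IsProbabilityMeasure (coinMeasure p) := by
  constructor
  have h : ENNReal.ofReal p + ENNReal.ofReal (1 - p) = 1 := by
    rw [← ENNReal.ofReal_add p.2.1 (sub_nonneg.2 p.2.2)]
    simp
  simpa [coinMeasure] using h

theorem integral_coinMeasure (p : Set.Icc (0 : ℝ) 1) (f : Bool → ℝ) :
    ∫ b, f b ∂(coinMeasure p) = p * f true + (1 - p) * f false := by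
  have h := p.2
  have := Measure.smul_finite (Measure.dirac true) (ENNReal.ofReal_ne_top (r := (p : ℝ)))
  have := Measure.smul_finite (Measure.dirac false) (ENNReal.ofReal_ne_top (r := 1 - (p : ℝ)))
  rw [coinMeasure, integral_add_measure (Integrable.of_finite) (Integrable.of_finite),
    integral_smul_measure, integral_smul_measure, integral_dirac, integral_dirac,
    ENNReal.toReal_ofReal h.1, ENNReal.toReal_ofReal (sub_nonneg.2 h.2), smul_eq_mul, smul_eq_mul]

variable {n : ℕ}

/-- The index of the coin that decides about the edge `uv`. -/
def edgeIndex (u v : Fin n) : Fin n × Fin n := (max u v, min u v)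

theorem edgeIndex_comm (u v : Fin n) : edgeIndex u v = edgeIndex v u := by
  rw [edgeIndex, edgeIndex, max_comm, min_comm]

theorem edgeIndex_eq_iff {u v u' v' : Fin n} :
    edgeIndex u v = edgeIndex u' v' ↔ (u = u' ∧ v = v') ∨ (u = v' ∧ v = u') := by
  simp only [edgeIndex, Prod.mk.injEq]
  constructor
  · rintro ⟨h1, h2⟩
    rcases le_total u v with h | h <;> rcases le_total u' v' with h' | h' <;>
      simp_all
  · rintro (⟨rfl, rfl⟩ | ⟨rfl, rfl⟩)
    · simp
    · simp [max_comm, min_comm]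

theorem edgeIndex_injective (u : Fin n) : Function.Injective (edgeIndex u) := by
  intro v w h
  rcases edgeIndex_eq_iff.1 h with ⟨-, h⟩ | ⟨h1, h2⟩
  · exact h
  · rw [h2, h1]

/-- The graph determined by the coin flips. -/
noncomputable def coinGraph (ω : Fin n × Fin n → Bool) : SimpleGraph (Fin n) where
  Adj u v := u ≠ v ∧ ω (edgeIndex u v) = true
  symm := ⟨fun u v h => ⟨h.1.symm, edgeIndex_comm u v ▸ h.2⟩⟩
  loopless := ⟨fun _ h => h.1 rfl⟩

/-- Independent coins with the given success probabilities. -/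
noncomputable def coinsMeasure (p : Fin n × Fin n → Set.Icc (0 : ℝ) 1) : Measure (Fin n × Fin n → Bool) :=
  Measure.pi fun e => coinMeasure (p e)

instance (p : Fin n × Fin n → Set.Icc (0 : ℝ) 1) : IsProbabilityMeasure (coinsMeasure p) := by
  unfold coinsMeasure; infer_instance

/-- This realises the conditional law of the graph on a product space, where edges are independent.
Prescribing the graph fixes the coins `(u, v)` with `v < u` and leaves the others free, so the
product measure returns the likelihood. -/
theorem coinsMeasure_coinGraph_eq {ι : Type*} [Fintype ι] {x : Fin n → ι → ℝ}
    {p : Fin n × Fin n → Set.Icc (0 : ℝ) 1} (hp : ∀ e, (p e : ℝ) = x e.1 ⬝ᵥ x e.2)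
    (G : SimpleGraph (Fin n)) :
    coinsMeasure p {ω | coinGraph ω = G} = ENNReal.ofReal (edgeLikelihood x G) := by
  classical
  have hset : {ω | coinGraph ω = G} = Set.pi Set.univ fun e : Fin n × Fin n =>
      if e.2 < e.1 then {decide (G.Adj e.1 e.2)} else Set.univ := by
    ext ω
    simp only [Set.mem_pi, Set.mem_univ, true_imp_iff]
    constructor
    · rintro (rfl : coinGraph ω = G) ⟨u, v⟩
      split_ifs with h
      · have h' : v < u := h
        simp [coinGraph, edgeIndex, max_eq_left h'.le, min_eq_right h'.le, h'.ne']
      · trivial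
    · intro h
      have key : ∀ u v : Fin n, v < u → ((coinGraph ω).Adj u v ↔ G.Adj u v) := by
        intro u v huv
        have := h (u, v)
        rw [if_pos huv, Set.mem_singleton_iff] at this
        simp [coinGraph, edgeIndex, max_eq_left huv.le, min_eq_right huv.le, huv.ne', this]
      change coinGraph ω = G
      ext u v
      rcases lt_trichotomy u v with huv | rfl | huv
      · rw [SimpleGraph.adj_comm, key v u huv, SimpleGraph.adj_comm]
      · simp
      · exact key u v huv
  rw [hset, coinsMeasure, Measure.pi_pi, Fintype.prod_prod_type, edgeLikelihood,
    ENNReal.ofReal_prod_of_nonneg]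
  · refine Finset.prod_congr rfl fun u _ => ?_
    rw [ENNReal.ofReal_prod_of_nonneg]
    · rw [← Finset.prod_subset (Finset.subset_univ (Finset.Iio u))]
      · refine Finset.prod_congr rfl fun v hv => ?_
        rw [if_pos (by simpa using hv), coinMeasure_singleton, hp]
        simp
      · intro v _ hv
        rw [if_neg (by simpa using hv), measure_univ]
    · intro v _
      have := (p (u, v)).2
      rw [hp] at this
      split_ifs
      exacts [this.1, sub_nonneg.2 this.2]
  · intro u _
    refine Finset.prod_nonneg fun v _ => ?_
    have := (p (u, v)).2
    rw [hp] at this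
    split_ifs
    exacts [this.1, sub_nonneg.2 this.2]

theorem sum_edgeLikelihood_eq {ι : Type*} [Fintype ι] {x : Fin n → ι → ℝ}
    {p : Fin n × Fin n → Set.Icc (0 : ℝ) 1} (hp : ∀ e, (p e : ℝ) = x e.1 ⬝ᵥ x e.2)
    (S : Finset (SimpleGraph (Fin n))) :
    ∑ G ∈ S, ENNReal.ofReal (edgeLikelihood x G) = coinsMeasure p {ω | coinGraph ω ∈ S} := by
  simp only [← coinsMeasure_coinGraph_eq hp]
  exact sum_measure_preimage_singleton S fun G _ => Set.Finite.measurableSet (Set.toFinite _)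

end EdgeMeasure

/-! ### Concentration of row sums and row products of the coins -/

section EdgeMeasure

open MeasureTheory ProbabilityTheory

/-- By Fubini for the product law of `(f, g)`: a bound that holds with `f` frozen at any value
survives averaging over `f`. -/
theorem IndepFun.measureReal_preimage_le {Ω β γ : Type*} [MeasurableSpace Ω] [MeasurableSpace β]
    [MeasurableSpace γ] {μ : Measure Ω} [IsProbabilityMeasure μ] {f : Ω → β} {g : Ω → γ}
    (h : IndepFun f g μ) (hf : Measurable f) (hg : Measurable g) {B : Set (β × γ)}
    (hB : MeasurableSet B) {δ : ℝ} (hδ : ∀ ω, μ.real {ω' | (f ω, g ω') ∈ B} ≤ δ) :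
    μ.real {ω | (f ω, g ω) ∈ B} ≤ δ := by
  obtain ⟨ω₀⟩ : Nonempty Ω := nonempty_of_isProbabilityMeasure μ
  have hδ0 : 0 ≤ δ := measureReal_nonneg.trans (hδ ω₀)
  refine ENNReal.toReal_le_of_le_ofReal hδ0 ?_
  have h1 : μ {ω | (f ω, g ω) ∈ B} = (μ.map fun ω => (f ω, g ω)) B :=
    (Measure.map_apply (hf.prodMk hg) hB).symm
  have := Measure.isProbabilityMeasure_map (μ := μ) hg.aemeasurable
  rw [h1, (indepFun_iff_map_prod_eq_prod_map_map hf.aemeasurable hg.aemeasurable).1 h,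
    Measure.prod_apply hB, lintegral_map (measurable_measure_prodMk_left hB) hf]
  calc _ ≤ ∫⁻ _, ENNReal.ofReal δ ∂μ := by
        refine lintegral_mono fun ω => ?_
        rw [Measure.map_apply hg (measurable_prodMk_left hB),
          ENNReal.le_ofReal_iff_toReal_le (measure_ne_top _ _) hδ0]
        exact hδ ω
    _ = _ := by simp

variable {n : ℕ} {p : Fin n × Fin n → Set.Icc (0 : ℝ) 1}

/-- The centered indicator of the coin `e`. -/
def coinNoise (p : Fin n × Fin n → Set.Icc (0 : ℝ) 1) (e : Fin n × Fin n)
    (ω : Fin n × Fin n → Bool) : ℝ :=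
  (if ω e then 1 else 0) - p e

theorem measurable_coinNoise (e : Fin n × Fin n) : Measurable (coinNoise p e) :=
  measurable_of_finite _

theorem abs_coinNoise_le (e : Fin n × Fin n) (ω : Fin n × Fin n → Bool) :
    |coinNoise p e ω| ≤ 1 := by
  have h := (p e).2
  rw [coinNoise, abs_le]
  split_ifs
  · constructor <;> linarith [h.1, h.2]
  · constructor <;> linarith [h.1, h.2]

theorem iIndepFun_coinNoise : iIndepFun (coinNoise p) (coinsMeasure p) :=
  iIndepFun_pi (μ := fun e => coinMeasure (p e)) (X := fun e b => (if b then 1 else 0) - (p e : ℝ))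
    fun _ => (measurable_of_finite _).aemeasurable

theorem integral_coinNoise (e : Fin n × Fin n) : ∫ ω, coinNoise p e ω ∂(coinsMeasure p) = 0 := by
  have h := integral_comp_eval (μ := fun e => coinMeasure (p e)) (i := e)
    (f := fun b : Bool => (if b then 1 else 0) - (p e : ℝ))
    (measurable_of_finite _).aestronglyMeasurable
  refine h.trans ?_
  rw [integral_coinMeasure]
  simp
  ring

theorem measureReal_abs_row_ge_le (u : Fin n) {c : Fin n → ℝ} (hc : ∀ w, |c w| ≤ 1) {ε : ℝ}
    (hε : 0 < ε) : (coinsMeasure p).real {ω | ε * n ≤ |∑ w, c w * coinNoise p (edgeIndex u w) ω|} ≤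
      2 * Real.exp (-(ε ^ 2 / 2) * n) := by
  refine measureReal_abs_sum_ge_le (Y := fun w ω => c w * coinNoise p (edgeIndex u w) ω)
    ((iIndepFun_coinNoise.precomp (edgeIndex_injective u)).comp (fun w y => c w * y)
      fun w => measurable_const_mul _) (fun w => (measurable_coinNoise _).const_mul _)
    (fun w ω => ?_) (fun w => ?_) (by simp) hε u.pos
  · rw [abs_mul]
    exact mul_le_one₀ (hc w) (abs_nonneg _) (abs_coinNoise_le _ _)
  · rw [integral_const_mul, integral_coinNoise, mul_zero]

/-- Away from `w = u` and `w = v`, the edges at `u` and those at `v` use disjoint sets of coins.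
Freezing the coins at `u` leaves a row sum at `v` with coefficients in `[-1, 1]`. -/
theorem measureReal_abs_pair_ge_le {u v : Fin n} (huv : u ≠ v) {ε : ℝ} (hε : 0 < ε) :
    (coinsMeasure p).real {ω | ε * n ≤ |∑ w, (if w = u ∨ w = v then 0 else
      coinNoise p (edgeIndex u w) ω) * coinNoise p (edgeIndex v w) ω|} ≤
      2 * Real.exp (-(ε ^ 2 / 2) * n) := by
  classical
  set W : Finset (Fin n) := Finset.univ.filter fun w => ¬(w = u ∨ w = v) with hW
  set S := W.image (edgeIndex u)
  set T := W.image (edgeIndex v)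
  have hST : Disjoint S T := by
    rw [Finset.disjoint_left]
    intro e he he'
    obtain ⟨w, hw, rfl⟩ := Finset.mem_image.1 he
    obtain ⟨w', hw', h⟩ := Finset.mem_image.1 he'
    simp only [hW, Finset.mem_filter, Finset.mem_univ, true_and, not_or] at hw hw'
    rcases edgeIndex_eq_iff.1 h with ⟨h1, -⟩ | ⟨h1, -⟩
    · exact huv h1.symm
    · exact hw.2 h1.symm
  have hind := iIndepFun_coinNoise (p := p).indepFun_finset S T hST measurable_coinNoise
  have hmem : ∀ t w, ¬(w = u ∨ w = v) → edgeIndex t w ∈ W.image (edgeIndex t) := fun t w hw =>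
    Finset.mem_image_of_mem _ (by simpa [hW] using hw)
  have hφ : Measurable fun (g : S → ℝ) (w : Fin n) =>
      if h : w = u ∨ w = v then 0 else g ⟨edgeIndex u w, hmem u w h⟩ := by
    refine measurable_pi_lambda _ fun w => ?_
    split_ifs
    exacts [measurable_const, measurable_pi_apply _]
  have hψ : Measurable fun (g : T → ℝ) (w : Fin n) =>
      if h : w = u ∨ w = v then 0 else g ⟨edgeIndex v w, hmem v w h⟩ := by
    refine measurable_pi_lambda _ fun w => ?_
    split_ifs
    exacts [measurable_const, measurable_pi_apply _]
  have hB : MeasurableSet {z : (Fin n → ℝ) × (Fin n → ℝ) | ε * n ≤ |∑ w, z.1 w * z.2 w|} := by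
    refine measurableSet_le measurable_const (Measurable.abs ?_)
    exact Finset.measurable_sum _ fun w _ =>
      ((measurable_pi_apply w).comp measurable_fst).mul ((measurable_pi_apply w).comp measurable_snd)
  refine le_trans (measureReal_mono fun ω hω => ?_)
    (IndepFun.measureReal_preimage_le (hind.comp hφ hψ) (measurable_of_finite _)
      (measurable_of_finite _) hB fun ω => (le_trans (measureReal_mono fun ω' hω' => ?_)
        (measureReal_abs_row_ge_le (p := p) v
          (c := fun w => if w = u ∨ w = v then 0 else coinNoise p (edgeIndex u w) ω)
          (fun w => ?_) hε)))
  · refine le_of_le_of_eq (show ε * n ≤ _ from hω) (congrArg abs ?_)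
    refine Finset.sum_congr rfl fun w _ => ?_
    by_cases h : w = u ∨ w = v <;> simp [h]
  · refine le_of_le_of_eq (show ε * n ≤ _ from hω') (congrArg abs ?_)
    refine Finset.sum_congr rfl fun w _ => ?_
    by_cases h : w = u ∨ w = v <;> simp [h]
  · split_ifs
    · simp
    · exact abs_coinNoise_le _ _

end EdgeMeasure

/-! ### From concentrated sums to norm bounds on the noise matrix -/

section Concentration

open MeasureTheory

variable {ι : Type*} [Fintype ι] {n : ℕ}

/-- The deviation of the adjacency matrix of `G` from the matrix of inner products of `x`. -/
noncomputable def noiseMatrix (x : Fin n → ι → ℝ) (G : SimpleGraph (Fin n)) :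
    Matrix (Fin n) (Fin n) ℝ :=
  open scoped Classical in
  G.adjMatrix ℝ - Matrix.of x * (Matrix.of x)ᵀ

/-- The off-diagonal sums controlling the noise matrix are at most `ε * n`. -/
def IsConcentrated (x : Fin n → ι → ℝ) (G : SimpleGraph (Fin n)) (ε : ℝ) : Prop :=
  (∀ u a, |∑ w, if w = u then 0 else noiseMatrix x G u w * x w a| < ε * n) ∧
    ∀ u v, u ≠ v →
      |∑ w, if w = u ∨ w = v then 0 else noiseMatrix x G u w * noiseMatrix x G v w| < ε * n

theorem noiseMatrix_apply (x : Fin n → ι → ℝ) (G : SimpleGraph (Fin n)) [DecidableRel G.Adj]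
    (u v : Fin n) : noiseMatrix x G u v = (if G.Adj u v then 1 else 0) - x u ⬝ᵥ x v := by
  simp [noiseMatrix, Matrix.mul_apply, dotProduct, SimpleGraph.adjMatrix_apply]

theorem noiseMatrix_coinGraph {x : Fin n → ι → ℝ} {p : Fin n × Fin n → Set.Icc (0 : ℝ) 1}
    (hp : ∀ e, (p e : ℝ) = x e.1 ⬝ᵥ x e.2) (ω : Fin n × Fin n → Bool) {u v : Fin n} (huv : v ≠ u) :
    noiseMatrix x (coinGraph ω) u v = coinNoise p (edgeIndex u v) ω := by
  classical
  have h : x (edgeIndex u v).1 ⬝ᵥ x (edgeIndex u v).2 = x u ⬝ᵥ x v := by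
    rcases le_total u v with h | h
    · simp [edgeIndex, h, dotProduct_comm]
    · simp [edgeIndex, h]
  rw [noiseMatrix_apply, coinNoise, hp, h]
  simp [coinGraph, huv.symm]

theorem noiseMatrix_comm (x : Fin n → ι → ℝ) (G : SimpleGraph (Fin n)) (u v : Fin n) :
    noiseMatrix x G u v = noiseMatrix x G v u := by
  classical
  rw [noiseMatrix_apply, noiseMatrix_apply, dotProduct_comm]
  simp [SimpleGraph.adj_comm]

theorem abs_noiseMatrix_le {x : Fin n → ι → ℝ} (hx : ∀ u v, x u ⬝ᵥ x v ∈ Set.Icc (0 : ℝ) 1)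
    (G : SimpleGraph (Fin n)) (u v : Fin n) : |noiseMatrix x G u v| ≤ 1 := by
  classical
  have h := hx u v
  rw [noiseMatrix_apply, abs_le]
  split_ifs
  · constructor <;> linarith [h.1, h.2]
  · constructor <;> linarith [h.1, h.2]

theorem abs_apply_le_one_of_dotProduct_self_le {y : ι → ℝ} (h : y ⬝ᵥ y ≤ 1) (a : ι) :
    |y a| ≤ 1 := by
  have h1 : y a * y a ≤ y ⬝ᵥ y :=
    Finset.single_le_sum (f := fun a => y a * y a) (fun a _ => mul_self_nonneg _)
      (Finset.mem_univ a)
  rw [abs_le_one_iff_mul_self_le_one]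
  linarith

/-- A union bound over the pairs (vertex, coordinate) and the pairs of vertices. Off the diagonal
the noise entries are centred coins; the diagonal ones are not, which is why concentration leaves
them out. -/
theorem sum_edgeLikelihood_not_isConcentrated_le {x : Fin n → ι → ℝ}
    (hx : ∀ u v, x u ⬝ᵥ x v ∈ Set.Icc (0 : ℝ) 1) {ε : ℝ} (hε : 0 < ε)
    (S : Finset (SimpleGraph (Fin n))) (hS : ∀ G ∈ S, ¬IsConcentrated x G ε) :
    ∑ G ∈ S, ENNReal.ofReal (edgeLikelihood x G) ≤
      ENNReal.ofReal ((n * Fintype.card ι + n * n) * (2 * Real.exp (-(ε ^ 2 / 2) * n))) := by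
  set p : Fin n × Fin n → Set.Icc (0 : ℝ) 1 := fun e => ⟨x e.1 ⬝ᵥ x e.2, hx _ _⟩
  have hp : ∀ e, (p e : ℝ) = x e.1 ⬝ᵥ x e.2 := fun e => rfl
  rw [sum_edgeLikelihood_eq hp, ENNReal.le_ofReal_iff_toReal_le (measure_ne_top _ _)
    (by positivity)]
  set B₁ : Fin n × ι → Set (Fin n × Fin n → Bool) := fun k =>
    {ω | ε * n ≤ |∑ w, (if w = k.1 then 0 else x w k.2) * coinNoise p (edgeIndex k.1 w) ω|}
  set B₂ : Fin n × Fin n → Set (Fin n × Fin n → Bool) := fun k =>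
    if k.1 = k.2 then ∅ else
      {ω | ε * n ≤ |∑ w, (if w = k.1 ∨ w = k.2 then 0 else
        coinNoise p (edgeIndex k.1 w) ω) * coinNoise p (edgeIndex k.2 w) ω|}
  have hsub : {ω | coinGraph ω ∈ S} ⊆ (⋃ k, B₁ k) ∪ ⋃ k, B₂ k := by
    intro ω hω
    by_contra hnot
    simp only [Set.mem_union, Set.mem_iUnion, not_or, not_exists] at hnot
    refine hS _ hω ⟨fun u a => ?_, fun u v huv => ?_⟩
    · refine lt_of_eq_of_lt (congrArg abs ?_) (not_le.1 (hnot.1 (u, a)))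
      refine Finset.sum_congr rfl fun w _ => ?_
      by_cases h : w = u
      · simp [h]
      · simp only [h, if_false]
        rw [noiseMatrix_coinGraph hp ω h, mul_comm]
    · have h2 := hnot.2 (u, v)
      simp only [B₂, huv, if_false] at h2
      refine lt_of_eq_of_lt (congrArg abs ?_) (not_le.1 h2)
      refine Finset.sum_congr rfl fun w _ => ?_
      by_cases h : w = u ∨ w = v
      · simp [h]
      · rw [if_neg h, if_neg h, noiseMatrix_coinGraph hp ω fun h' => h (Or.inl h'),
          noiseMatrix_coinGraph hp ω fun h' => h (Or.inr h')]
  have h₁ : ∀ k, (coinsMeasure p).real (B₁ k) ≤ 2 * Real.exp (-(ε ^ 2 / 2) * n) := fun k =>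
    measureReal_abs_row_ge_le k.1 (fun w => by
      split_ifs
      · simp
      · exact abs_apply_le_one_of_dotProduct_self_le (hx w w).2 _) hε
  have h₂ : ∀ k, (coinsMeasure p).real (B₂ k) ≤ 2 * Real.exp (-(ε ^ 2 / 2) * n) := fun k => by
    simp only [B₂]
    split_ifs with h
    · rw [measureReal_empty]; positivity
    · exact measureReal_abs_pair_ge_le h hε
  calc _ ≤ (coinsMeasure p).real ((⋃ k, B₁ k) ∪ ⋃ k, B₂ k) := measureReal_mono hsub
    _ ≤ (coinsMeasure p).real (⋃ k, B₁ k) + (coinsMeasure p).real (⋃ k, B₂ k) :=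
        measureReal_union_le _ _
    _ ≤ ∑ k, (coinsMeasure p).real (B₁ k) + ∑ k, (coinsMeasure p).real (B₂ k) :=
        add_le_add (measureReal_iUnion_fintype_le _) (measureReal_iUnion_fintype_le _)
    _ ≤ ∑ _ : Fin n × ι, 2 * Real.exp (-(ε ^ 2 / 2) * n) +
          ∑ _ : Fin n × Fin n, 2 * Real.exp (-(ε ^ 2 / 2) * n) :=
        add_le_add (Finset.sum_le_sum fun k _ => h₁ k) (Finset.sum_le_sum fun k _ => h₂ k)
    _ = _ := by
        simp only [Finset.sum_const, Finset.card_univ, Fintype.card_prod, Fintype.card_fin,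
          nsmul_eq_mul]
        push_cast
        ring

section Deterministic

variable {x : Fin n → ι → ℝ} {G : SimpleGraph (Fin n)} {ε e : ℝ}

theorem IsConcentrated.transpose_mulVec_noise_le (h : IsConcentrated x G ε)
    (hx : ∀ u v, x u ⬝ᵥ x v ∈ Set.Icc (0 : ℝ) 1) (hn : 2 ≤ ε * n) (hε1 : ε ≤ 1) (hε : 0 < ε)
    (he : 4 * (Fintype.card ι + 1) * ε ≤ e ^ 2) (u : Fin n) :
    ((Matrix.of x)ᵀ *ᵥ noiseMatrix x G u) ⬝ᵥ ((Matrix.of x)ᵀ *ᵥ noiseMatrix x G u) ≤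
      (e * n) ^ 2 := by
  -- The omitted diagonal term is at most `1 ≤ ε n`, whence the factor `2`.
  have hcoord : ∀ a, |((Matrix.of x)ᵀ *ᵥ noiseMatrix x G u) a| ≤ 2 * (ε * n) := by
    intro a
    have h1 : ((Matrix.of x)ᵀ *ᵥ noiseMatrix x G u) a =
        (∑ w, if w = u then 0 else noiseMatrix x G u w * x w a) + noiseMatrix x G u u * x u a := by
      have h2 : noiseMatrix x G u u * x u a =
          ∑ w, if w = u then noiseMatrix x G u w * x w a else 0 := by simp
      rw [h2, ← Finset.sum_add_distrib, Matrix.mulVec, dotProduct]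
      refine Finset.sum_congr rfl fun w _ => ?_
      split_ifs <;> simp [mul_comm]
    have h3 : |noiseMatrix x G u u * x u a| ≤ 1 := by
      rw [abs_mul]
      exact mul_le_one₀ (abs_noiseMatrix_le hx G u u) (abs_nonneg _)
        (abs_apply_le_one_of_dotProduct_self_le (hx u u).2 a)
    rw [h1]
    have := abs_add_le (∑ w, if w = u then 0 else noiseMatrix x G u w * x w a)
      (noiseMatrix x G u u * x u a)
    linarith [h.1 u a]
  calc _ ≤ ∑ _ : ι, (2 * (ε * n)) ^ 2 := by
        refine Finset.sum_le_sum fun a _ => ?_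
        rw [← sq, ← sq_abs]
        exact pow_le_pow_left₀ (abs_nonneg _) (hcoord a) 2
    _ = 4 * Fintype.card ι * ε * ε * n ^ 2 := by
        rw [Finset.sum_const, Finset.card_univ, nsmul_eq_mul]; ring
    _ ≤ 4 * Fintype.card ι * ε * 1 * n ^ 2 := by gcongr
    _ ≤ e ^ 2 * n ^ 2 := by
        gcongr
        nlinarith
    _ = _ := by ring

/-- Expand `|E y|²` through the entries of `E Eᵀ`: the diagonal ones are at most `n`, the others at
most `2 ε n`, and `(∑ |y u|)² ≤ n |y|²`. The total is at most `(n + 2 ε n²) |y|²`, and `n ≤ ε n²`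
since `ε n ≥ 2`. -/
theorem IsConcentrated.noise_mulVec_le (h : IsConcentrated x G ε)
    (hx : ∀ u v, x u ⬝ᵥ x v ∈ Set.Icc (0 : ℝ) 1) (hn : 2 ≤ ε * n)
    (he : 4 * (Fintype.card ι + 1) * ε ≤ e ^ 2) (y : Fin n → ℝ) :
    (noiseMatrix x G *ᵥ y) ⬝ᵥ (noiseMatrix x G *ᵥ y) ≤ (e * n) ^ 2 * (y ⬝ᵥ y) := by
  set E := noiseMatrix x G with hE
  have hE1 : ∀ u v w, |E u w * E v w| ≤ 1 := fun u v w => by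
    rw [abs_mul]
    exact mul_le_one₀ (abs_noiseMatrix_le hx G u w) (abs_nonneg _) (abs_noiseMatrix_le hx G v w)
  have hdiag : ∀ u, |∑ w, E u w * E u w| ≤ n := fun u => by
    refine (Finset.abs_sum_le_sum_abs _ _).trans ?_
    refine (Finset.sum_le_sum fun w _ => hE1 u u w).trans ?_
    simp
  have hoff : ∀ u v, u ≠ v → |∑ w, E u w * E v w| ≤ 2 * (ε * n) := fun u v huv => by
    have h1 : ∑ w, E u w * E v w = (∑ w, if w = u ∨ w = v then 0 else E u w * E v w) +
        (E u u * E v u + E u v * E v v) := by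
      have h2 : E u u * E v u + E u v * E v v =
          ∑ w, ((if w = u then E u w * E v w else 0) + if w = v then E u w * E v w else 0) := by
        rw [Finset.sum_add_distrib]; simp
      rw [h2, ← Finset.sum_add_distrib]
      refine Finset.sum_congr rfl fun w _ => ?_
      by_cases h3 : w = u
      · subst h3; simp [huv]
      · by_cases h4 : w = v
        · subst h4; simp [h3]
        · simp [h3, h4]
    rw [h1]
    have t1 := abs_add_le (∑ w, if w = u ∨ w = v then 0 else E u w * E v w)
      (E u u * E v u + E u v * E v v)
    have t2 := abs_add_le (E u u * E v u) (E u v * E v v)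
    linarith [h.2 u v huv, hE1 u v u, hE1 u v v]
  have hexp : (E *ᵥ y) ⬝ᵥ (E *ᵥ y) = ∑ u, ∑ v, y u * y v * ∑ w, E u w * E v w := by
    calc (E *ᵥ y) ⬝ᵥ (E *ᵥ y) = ∑ w, ∑ u, ∑ v, y u * y v * (E u w * E v w) := by
          refine Finset.sum_congr rfl fun w _ => ?_
          rw [Matrix.mulVec, dotProduct, Finset.sum_mul_sum]
          refine Finset.sum_congr rfl fun u _ => Finset.sum_congr rfl fun v _ => ?_
          rw [hE, noiseMatrix_comm x G w u, noiseMatrix_comm x G w v]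
          ring
      _ = _ := by
          rw [Finset.sum_comm]
          refine Finset.sum_congr rfl fun u _ => ?_
          rw [Finset.sum_comm]
          exact Finset.sum_congr rfl fun v _ => (Finset.mul_sum _ _ _).symm
  have hterm : ∀ u v, y u * y v * ∑ w, E u w * E v w ≤
      (if u = v then n * (y u * y v) else 0) + 2 * (ε * n) * (|y u| * |y v|) := by
    intro u v
    have h1 : y u * y v * ∑ w, E u w * E v w ≤ |y u| * |y v| * |∑ w, E u w * E v w| := by
      rw [← abs_mul, ← abs_mul]
      exact le_abs_self _
    by_cases huv : u = v
    · subst huv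
      rw [if_pos rfl]
      have h2 := mul_le_mul_of_nonneg_left (hdiag u) (mul_self_nonneg (y u))
      rw [abs_mul_abs_self] at h1 ⊢
      have h3 : 0 ≤ 2 * (ε * n) * (y u * y u) := mul_nonneg (by linarith) (mul_self_nonneg _)
      linarith
    · rw [if_neg huv]
      have h2 := mul_le_mul_of_nonneg_left (hoff u v huv)
        (mul_nonneg (abs_nonneg (y u)) (abs_nonneg (y v)))
      linarith
  have hl1 : ∑ u, ∑ v, |y u| * |y v| ≤ n * (y ⬝ᵥ y) := by
    rw [← Finset.sum_mul_sum, ← sq]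
    have := sq_sum_le_card_mul_sum_sq (s := Finset.univ) (f := fun u => |y u|)
    simpa [dotProduct, ← sq] using this
  rw [hexp]
  calc _ ≤ ∑ u, ∑ v, ((if u = v then n * (y u * y v) else 0) +
          2 * (ε * n) * (|y u| * |y v|)) :=
        Finset.sum_le_sum fun u _ => Finset.sum_le_sum fun v _ => hterm u v
    _ = n * (y ⬝ᵥ y) + 2 * (ε * n) * ∑ u, ∑ v, |y u| * |y v| := by
        simp only [Finset.sum_add_distrib, Finset.mul_sum, dotProduct]
        simp
    _ ≤ n * (y ⬝ᵥ y) + 2 * (ε * n) * (n * (y ⬝ᵥ y)) := by gcongr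
    _ ≤ (ε * n) * n * (y ⬝ᵥ y) + 2 * (ε * n) * (n * (y ⬝ᵥ y)) := by
        have h0 := dotProduct_self_nonneg y
        have : (n : ℝ) ≤ ε * n * n := by
          have : (0 : ℝ) ≤ n := Nat.cast_nonneg n
          nlinarith
        gcongr
    _ = 3 * ε * (n ^ 2 * (y ⬝ᵥ y)) := by ring
    _ ≤ e ^ 2 * (n ^ 2 * (y ⬝ᵥ y)) := by
        have h0 := dotProduct_self_nonneg y
        gcongr
        have : (0 : ℝ) ≤ Fintype.card ι := Nat.cast_nonneg _
        nlinarith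
    _ = _ := by ring

end Deterministic

end Concentration

/-! ### Conditioning on latent positions, block sizes and coercivity -/

section Model

open MeasureTheory ProbabilityTheory

theorem measurable_edgeLikelihood {ι : Type*} [Fintype ι] {n : ℕ} (G : SimpleGraph (Fin n)) :
    Measurable fun x : Fin n → ι → ℝ => edgeLikelihood x G := by
  classical
  have h : ∀ i j : Fin n, Measurable fun x : Fin n → ι → ℝ => x i ⬝ᵥ x j := fun i j =>
    Finset.measurable_sum _ fun a _ => by fun_prop
  unfold edgeLikelihood
  refine Finset.measurable_prod _ fun i _ => Finset.measurable_prod _ fun j _ => ?_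
  split_ifs
  exacts [h i j, measurable_const.sub (h i j)]

/-- Under a random dot product graph, an event has probability at most `δ` if its conditional
probability given the latent positions is at most `δ`. -/
theorem IsRDPG.measure_le {Ω ι : Type*} [MeasurableSpace Ω] [Fintype ι] {n : ℕ}
    {μ : Measure Ω} [IsProbabilityMeasure μ] {F : Measure (ι → ℝ)} {X : Ω → Fin n → ι → ℝ}
    {A : Ω → SimpleGraph (Fin n)} (h : IsRDPG μ F X A)
    {B : SimpleGraph (Fin n) → Set (Fin n → ι → ℝ)} (hB : ∀ G, MeasurableSet (B G))
    {δ : ENNReal} (hδ : ∀ x, ∀ S : Finset (SimpleGraph (Fin n)), (∀ G ∈ S, x ∈ B G) →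
      ∑ G ∈ S, ENNReal.ofReal (edgeLikelihood x G) ≤ δ) :
    μ {ω | X ω ∈ B (A ω)} ≤ δ := by
  classical
  have hsub : {ω | X ω ∈ B (A ω)} ⊆ ⋃ G, {ω | A ω = G} ∩ X ⁻¹' B G := fun ω hω =>
    Set.mem_iUnion.2 ⟨A ω, rfl, hω⟩
  calc μ {ω | X ω ∈ B (A ω)} ≤ ∑ G, μ ({ω | A ω = G} ∩ X ⁻¹' B G) :=
        (measure_mono hsub).trans (measure_iUnion_fintype_le _ _)
    _ = ∑ G, ∫⁻ ω, (X ⁻¹' B G).indicator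
          (fun ω => ENNReal.ofReal (edgeLikelihood (X ω) G)) ω ∂μ := by
        refine Finset.sum_congr rfl fun G _ => ?_
        rw [h.cond_graph G _ (hB G), lintegral_indicator (h.measurable_latent (hB G))]
    _ = ∫⁻ ω, ∑ G, (X ⁻¹' B G).indicator
          (fun ω => ENNReal.ofReal (edgeLikelihood (X ω) G)) ω ∂μ := by
        refine (lintegral_finsetSum _ fun G _ => Measurable.indicator ?_
          (h.measurable_latent (hB G))).symm
        exact ((measurable_edgeLikelihood G).comp h.measurable_latent).ennreal_ofReal
    _ ≤ ∫⁻ _, δ ∂μ := by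
        refine lintegral_mono fun ω => ?_
        refine le_trans (le_of_eq ?_)
          (hδ (X ω) (Finset.univ.filter fun G => X ω ∈ B G) fun G hG => (Finset.mem_filter.1 hG).2)
        rw [Finset.sum_filter]
        exact Finset.sum_congr rfl fun G _ => by simp [Set.indicator_apply]
    _ = δ := by simp

variable {R : ℕ} {K d : Fin R → ℕ}

namespace HSBM

/-- The probability of block `a`. -/
def blockProb (P : HSBM R K d) (a : Σ i, Fin (K i)) : ℝ :=
  P.weight a.1 * P.blockWeight a.1 a.2

theorem blockProb_pos (P : HSBM R K d) (a : Σ i, Fin (K i)) : 0 < P.blockProb a :=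
  mul_pos (P.weight_pos _) (P.blockWeight_pos _ _)

theorem sum_blockProb (P : HSBM R K d) : ∑ a, P.blockProb a = 1 := by
  simp only [blockProb, Fintype.sum_sigma, ← Finset.mul_sum, P.blockWeight_sum, mul_one,
    P.weight_sum]

theorem distribution_eq (P : HSBM R K d) :
    P.distribution = ∑ a, ENNReal.ofReal (P.blockProb a) • Measure.dirac (P.ξ a) := by
  simp only [distribution, subgraphDistribution, Fintype.sum_sigma, Finset.smul_sum, smul_smul,
    blockProb]
  refine Finset.sum_congr rfl fun i _ => Finset.sum_congr rfl fun j _ => ?_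
  rw [ENNReal.ofReal_mul (P.weight_pos i).le]

theorem distribution_apply (P : HSBM R K d) (S : Set ((Σ i, Fin (d i)) → ℝ)) :
    P.distribution S = ∑ a, ENNReal.ofReal (P.blockProb a) * S.indicator 1 (P.ξ a) := by
  rw [distribution_eq, Measure.finsetSum_apply]
  simp [Measure.dirac_apply]

instance (P : HSBM R K d) : IsProbabilityMeasure P.distribution := by
  constructor
  rw [distribution_apply]
  simp only [Set.indicator_univ, Pi.one_apply, mul_one]
  rw [← ENNReal.ofReal_sum_of_nonneg fun a _ => (P.blockProb_pos a).le, P.sum_blockProb,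
    ENNReal.ofReal_one]

theorem integral_distribution (P : HSBM R K d) (f : ((Σ i, Fin (d i)) → ℝ) → ℝ) :
    ∫ x, f x ∂P.distribution = ∑ a, P.blockProb a * f (P.ξ a) := by
  rw [distribution_eq, integral_finsetSum_measure]
  · refine Finset.sum_congr rfl fun a _ => ?_
    rw [integral_smul_measure, integral_dirac, ENNReal.toReal_ofReal (P.blockProb_pos a).le,
      smul_eq_mul]
  · intro a _
    exact (integrable_dirac (by simp)).smul_measure ENNReal.ofReal_ne_top

theorem distribution_compl_range (P : HSBM R K d) : P.distribution (Set.range P.ξ)ᶜ = 0 := by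
  rw [distribution_apply]
  exact Finset.sum_eq_zero fun a _ => by
    have h : P.ξ a ∉ (Set.range P.ξ)ᶜ := fun h => h (Set.mem_range_self a)
    rw [Set.indicator_of_notMem h, mul_zero]

theorem blockProb_le_distribution_real (P : HSBM R K d) (a : Σ i, Fin (K i)) :
    P.blockProb a ≤ P.distribution.real {P.ξ a} := by
  rw [measureReal_def, ← ENNReal.ofReal_le_iff_le_toReal (measure_ne_top _ _), distribution_apply]
  refine le_trans (le_of_eq ?_) (Finset.single_le_sum (fun _ _ => zero_le) (Finset.mem_univ a))
  simp

/-- Full rank of the second moment matrix makes the block positions a coercive system. -/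
theorem exists_coercive (P : HSBM R K d) (hRank : (secondMoment P.distribution).rank = ∑ i, d i) :
    ∃ c : ℝ, 0 < c ∧ ∀ b, c * (b ⬝ᵥ b) ≤ ∑ a, (P.ξ a ⬝ᵥ b) ^ 2 := by
  have hinj : Function.Injective (secondMoment P.distribution).mulVecLin := by
    rw [← LinearMap.ker_eq_bot, ← Submodule.finrank_eq_zero]
    have h := (secondMoment P.distribution).mulVecLin.finrank_range_add_finrank_ker
    have h2 : Module.finrank ℝ (LinearMap.range (secondMoment P.distribution).mulVecLin)
        = ∑ i, d i := hRank
    rw [h2, Module.finrank_fintype_fun_eq_card, Fintype.card_sigma] at h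
    simpa using h
  -- The second moment matrix is `∑ a, blockProb a • ξ_a ξ_aᵀ`, so a vector orthogonal to all block
  -- positions lies in its kernel, which is trivial by full rank.
  have hker : LinearMap.ker (P.ξ.toLpLin 2 2) = ⊥ := by
    rw [LinearMap.ker_eq_bot']
    intro b hb
    have hb' : ∀ a, P.ξ a ⬝ᵥ b.ofLp = 0 := fun a => congrArg (fun y => y.ofLp a) hb
    have h0 : secondMoment P.distribution *ᵥ b.ofLp = 0 := by
      ext k
      simp only [Matrix.mulVec, dotProduct, secondMoment, Matrix.of_apply, integral_distribution,
        Finset.sum_mul, Pi.zero_apply]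
      rw [Finset.sum_comm]
      refine Finset.sum_eq_zero fun a _ => ?_
      have : ∑ l, P.blockProb a * (P.ξ a k * P.ξ a l) * b.ofLp l
          = P.blockProb a * P.ξ a k * (P.ξ a ⬝ᵥ b.ofLp) := by
        rw [dotProduct, Finset.mul_sum]
        exact Finset.sum_congr rfl fun l _ => by ring
      rw [this, hb', mul_zero]
    have h1 : b.ofLp = 0 := hinj (by simpa using h0)
    ext k
    exact congrFun h1 k
  obtain ⟨κ, hκ, hanti⟩ := LinearMap.exists_antilipschitzWith _ hker
  -- An injective linear map in finite dimension satisfies `|b| ≤ κ |ξ b|`; squaring gives the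
  -- constant.
  refine ⟨((κ : ℝ) ^ 2)⁻¹, by positivity, fun b => ?_⟩
  have h := hanti.le_mul_norm_sub (WithLp.toLp 2 b) 0
  simp only [map_zero, add_zero, norm_neg] at h
  have h2 := pow_le_pow_left₀ (norm_nonneg _) h 2
  rw [mul_pow, norm_toLp_sq_eq_dotProduct, EuclideanSpace.norm_sq_eq] at h2
  rw [inv_mul_le_iff₀ (by positivity)]
  refine h2.trans (le_of_eq ?_)
  congr 1
  refine Finset.sum_congr rfl fun a _ => ?_
  rw [Real.norm_eq_abs, sq_abs]
  rfl

/-- All latent positions are block positions. -/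
def IsSupported (P : HSBM R K d) {n : ℕ} (x : Fin n → (Σ i, Fin (d i)) → ℝ) : Prop :=
  ∀ v, x v ∈ Set.range P.ξ

/-- Finiteness makes every set of supported configurations measurable, the failure of concentration
among them. -/
theorem finite_isSupported (P : HSBM R K d) (n : ℕ) :
    {x : Fin n → (Σ i, Fin (d i)) → ℝ | P.IsSupported x}.Finite := by
  have : {x : Fin n → (Σ i, Fin (d i)) → ℝ | P.IsSupported x} =
      Set.pi Set.univ fun _ => Set.range P.ξ := by
    ext x; simp [IsSupported, Set.mem_pi]
  rw [this]
  exact Set.Finite.pi fun _ => Set.finite_range _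

theorem IsSupported.dotProduct_mem {P : HSBM R K d} {n : ℕ}
    {x : Fin n → (Σ i, Fin (d i)) → ℝ} (h : P.IsSupported x) (u v : Fin n) :
    x u ⬝ᵥ x v ∈ Set.Icc (0 : ℝ) 1 := by
  obtain ⟨a, ha⟩ := h u
  obtain ⟨b, hb⟩ := h v
  rw [← ha, ← hb]
  exact P.inner_mem a b

theorem measure_not_isSupported (P : HSBM R K d) (n : ℕ) :
    (Measure.pi fun _ : Fin n => P.distribution) {x | ¬P.IsSupported x} = 0 := by
  have hsub : {x | ¬P.IsSupported x} ⊆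
      ⋃ v : Fin n, Function.eval v ⁻¹' (Set.range P.ξ)ᶜ := by
    intro x hx
    obtain ⟨v, hv⟩ := not_forall.1 hx
    exact Set.mem_iUnion.2 ⟨v, hv⟩
  refine measure_mono_null hsub (measure_iUnion_null fun v => ?_)
  have hm : MeasurableSet (Set.range P.ξ)ᶜ := (Set.finite_range _).measurableSet.compl
  rw [(measurePreserving_eval (fun _ : Fin n => P.distribution) v).measure_preimage
    hm.nullMeasurableSet, distribution_compl_range]

/-- The number of vertices of block `a`. -/
noncomputable def blockCount (P : HSBM R K d) {n : ℕ} (x : Fin n → (Σ i, Fin (d i)) → ℝ)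
    (a : Σ i, Fin (K i)) : ℝ :=
  ∑ v, Set.indicator {P.ξ a} (fun _ => (1 : ℝ)) (x v)

theorem measurable_blockCount (P : HSBM R K d) {n : ℕ} (a : Σ i, Fin (K i)) :
    Measurable fun x : Fin n → (Σ i, Fin (d i)) → ℝ => P.blockCount x a :=
  Finset.measurable_sum _ fun v _ =>
    (measurable_const.indicator (measurableSet_singleton _)).comp (measurable_pi_apply v)

/-- The expected count is at least `2 β n`, so a count below `β n` is a deviation of at least `β n`.
-/
theorem measureReal_blockCount_lt_le (P : HSBM R K d) {n : ℕ} (hn : 0 < n) {β : ℝ} (hβ : 0 < β)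
    {a : Σ i, Fin (K i)} (ha : 2 * β ≤ P.blockProb a) :
    (Measure.pi fun _ : Fin n => P.distribution).real {x | P.blockCount x a < β * n} ≤
      2 * Real.exp (-(β ^ 2 / 2) * n) := by
  set f : ((Σ i, Fin (d i)) → ℝ) → ℝ := fun y =>
    Set.indicator {P.ξ a} (fun _ => (1 : ℝ)) y - P.distribution.real {P.ξ a} with hf
  have hfm : Measurable f :=
    (measurable_const.indicator (measurableSet_singleton _)).sub measurable_const
  have h01 : P.distribution.real {P.ξ a} ≤ 1 := measureReal_le_one
  have h00 : 0 ≤ P.distribution.real {P.ξ a} := measureReal_nonneg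
  have hbd : ∀ y, |f y| ≤ 1 := by
    intro y
    rw [hf, abs_le]
    by_cases hy : y ∈ ({P.ξ a} : Set ((Σ i, Fin (d i)) → ℝ))
    · simp only [Set.indicator_of_mem hy]; constructor <;> linarith
    · simp only [Set.indicator_of_notMem hy]; constructor <;> linarith
  have hmean : ∫ y, f y ∂P.distribution = 0 := by
    rw [hf, integral_sub ((integrable_const _).indicator (measurableSet_singleton _))
      (integrable_const _), integral_indicator_const _ (measurableSet_singleton _)]
    simp
  refine le_trans (measureReal_mono fun x (hx : P.blockCount x a < β * n) => ?_)
    (measureReal_abs_sum_ge_le (μ := Measure.pi fun _ : Fin n => P.distribution)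
      (Y := fun v x => f (x v)) (iIndepFun_pi fun _ => hfm.aemeasurable)
      (fun v => hfm.comp (measurable_pi_apply v)) (fun v x => hbd _) (fun v => ?_)
      (by simp) hβ hn)
  · have h1 : ∑ v, f (x v) = P.blockCount x a - n * P.distribution.real {P.ξ a} := by
      simp [hf, Finset.sum_sub_distrib, blockCount]
    change β * n ≤ |∑ v, f (x v)|
    rw [h1]
    refine le_trans ?_ (neg_le_abs _)
    have h2 := ha.trans (P.blockProb_le_distribution_real a)
    have h3 : (0 : ℝ) < n := Nat.cast_pos.2 hn
    nlinarith
  · exact (integral_comp_eval (μ := fun _ : Fin n => P.distribution) (i := v)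
      hfm.aestronglyMeasurable).trans hmean

/-- Grouping the rows by block gives `|X b|² = ∑ a, blockCount a * (ξ_a · b)²`; distinct block
positions ensure that no row is counted twice. -/
theorem coercive_of_blockCount_ge (P : HSBM R K d) {n : ℕ} {x : Fin n → (Σ i, Fin (d i)) → ℝ}
    (hx : P.IsSupported x) {β c : ℝ} (hβ : 0 ≤ β)
    (hc : ∀ b, c * (b ⬝ᵥ b) ≤ ∑ a, (P.ξ a ⬝ᵥ b) ^ 2)
    (hcount : ∀ a, β * n ≤ P.blockCount x a) (b : (Σ i, Fin (d i)) → ℝ) :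
    (c * β * n) * (b ⬝ᵥ b) ≤ (Matrix.of x *ᵥ b) ⬝ᵥ (Matrix.of x *ᵥ b) := by
  have h1 : (Matrix.of x *ᵥ b) ⬝ᵥ (Matrix.of x *ᵥ b) =
      ∑ a, P.blockCount x a * (P.ξ a ⬝ᵥ b) ^ 2 := by
    simp only [blockCount, Finset.sum_mul]
    rw [Finset.sum_comm]
    refine Finset.sum_congr rfl fun v _ => ?_
    obtain ⟨a, ha⟩ := hx v
    rw [Finset.sum_eq_single a]
    · rw [Set.indicator_of_mem (by simp [ha]), one_mul, ha, sq]
      rfl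
    · intro a' _ ha'
      rw [Set.indicator_of_notMem, zero_mul]
      rw [Set.mem_singleton_iff, ← ha]
      exact fun h => ha' (P.distinct h).symm
    · simp
  rw [h1]
  calc (c * β * n) * (b ⬝ᵥ b) = (β * n) * (c * (b ⬝ᵥ b)) := by ring
    _ ≤ (β * n) * ∑ a, (P.ξ a ⬝ᵥ b) ^ 2 := by
        gcongr
        exact hc b
    _ ≤ _ := by
        rw [Finset.mul_sum]
        refine Finset.sum_le_sum fun a _ => ?_
        gcongr
        exact hcount a

end HSBM

end Model

/-! ### The good event and its probability -/

section Main

open MeasureTheory Filter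

theorem exists_nat_poly_mul_exp_le (M : ℝ) {κ : ℝ} (hκ : 0 < κ) (c : ℝ) :
    ∃ n₀ : ℕ, ∀ n : ℕ, n₀ < n → M * (n : ℝ) ^ 2 * Real.exp (-κ * n) ≤ (n : ℝ) ^ (-c) := by
  have h := (tendsto_rpow_mul_exp_neg_mul_atTop_nhds_zero (2 + c) κ hκ).comp
    (tendsto_natCast_atTop_atTop (R := ℝ))
  have h2 := h.const_mul M
  rw [mul_zero] at h2
  obtain ⟨n₀, hn₀⟩ := eventually_atTop.1 (h2.eventually_le_const one_pos)
  refine ⟨n₀, fun n hn => ?_⟩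
  have hn0 : (0 : ℝ) < n := Nat.cast_pos.2 (by omega)
  have h3 : M * ((n : ℝ) ^ (2 + c) * Real.exp (-κ * n)) ≤ 1 := hn₀ n hn.le
  rw [Real.rpow_add hn0, Real.rpow_two] at h3
  rw [Real.rpow_neg hn0.le, ← one_div, le_div_iff₀ (Real.rpow_pos_of_pos hn0 c)]
  linarith

variable {R : ℕ} {K d : Fin R → ℕ}

/-- On a supported, concentrated graph with large blocks, every seed selection succeeds. -/
theorem HSBM.hasExactlyOne_of_isConcentrated (P : HSBM R K d) {p q : ℝ} (hAff : P.Affinity p q)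
    {n : ℕ} {x : Fin n → (Σ i, Fin (d i)) → ℝ} (hx : P.IsSupported x) {G : SimpleGraph (Fin n)}
    {c β ε e : ℝ} (hc0 : 0 < c) (hβ : 0 < β)
    (hc : ∀ b, c * (b ⬝ᵥ b) ≤ ∑ a, (P.ξ a ⬝ᵥ b) ^ 2)
    (hcount : ∀ a, β * n ≤ P.blockCount x a) (hε : 0 < ε) (hε1 : ε ≤ 1) (he0 : 0 ≤ e)
    (he : 4 * (Fintype.card (Σ i, Fin (d i)) + 1) * ε ≤ e ^ 2) (hec : 4 * e ≤ c * β)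
    (hsmall : 8 * e / (c * β) ^ 2 + 3 * e / (c * β) < (q - p) / 2) (hn : 2 ≤ ε * n)
    (hG : IsConcentrated x G ε)
    {Xhat : Matrix (Fin n) (Fin (∑ i, d i)) ℝ}
    (hX : IsASE (open scoped Classical in G.adjMatrix ℝ) Xhat) {S₀ : Finset (Fin n)}
    (hS₀ : S₀.card = R) {Sn : Multiset (Fin n)} (hSn : IsFinalSeedSet Xhat S₀ Sn) (i : Fin R) :
    HasExactlyOne Xhat Sn (P.subgraph x i) := by
  classical
  have hn0 : (0 : ℝ) < n := by
    by_contra h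
    have : (n : ℝ) = 0 := le_antisymm (not_lt.1 h) (Nat.cast_nonneg n)
    rw [this, mul_zero] at hn
    linarith
  have hgram : ∀ u v, |Xhat u ⬝ᵥ Xhat v - x u ⬝ᵥ x v| < (q - p) / 2 := by
    intro u v
    -- The scales `m = c β n`, noise `e n` and `a = √n` make all powers of `n` cancel, which leaves
    -- the bound of `hsmall`.
    refine lt_of_le_of_lt (hX.abs_dotProduct_sub_le (X := Matrix.of x) (m := c * β * n) (e := e * n)
      (a := √n) ?_ (by simp) (by positivity) (by positivity) (by nlinarith)
      (P.coercive_of_blockCount_ge hx hβ.le hc hcount)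
      (fun y => hG.noise_mulVec_le hx.dotProduct_mem hn he y)
      (fun u => hG.transpose_mulVec_noise_le hx.dotProduct_mem hn hε1 hε he u)
      (fun u => (hx.dotProduct_mem u u).2) (Real.sqrt_nonneg _) (fun u => ?_) u v) ?_
    · exact SimpleGraph.transpose_adjMatrix G
    · rw [Real.sq_sqrt hn0.le]
      have : ∀ w, G.adjMatrix ℝ u w * G.adjMatrix ℝ u w ≤ 1 := fun w => by
        rw [SimpleGraph.adjMatrix_apply]; split_ifs <;> simp
      refine (Finset.sum_le_sum fun w _ => this w).trans ?_
      simp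
    · rw [Real.sq_sqrt hn0.le]
      refine lt_of_eq_of_lt ?_ hsmall
      field_simp
  choose τ hτ using hx
  have hsub : P.subgraph x i = {v | (τ v).1 = i} := by
    ext v
    constructor
    · rintro ⟨j, hj⟩
      have : τ v = ⟨i, j⟩ := P.distinct ((hτ v).trans hj)
      change (τ v).1 = i
      rw [this]
    · rintro rfl
      exact ⟨(τ v).2, (hτ v).symm⟩
  rw [hsub]
  refine hSn.hasExactlyOne (cls := fun v => (τ v).1) (t := (p + q) / 2) ?_ ?_ ?_ hS₀ i
  · intro u v (huv : (τ u).1 = (τ v).1)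
    have h1 : q ≤ x u ⬝ᵥ x v := by
      refine hAff.within.2 ?_
      rw [← hτ u, ← hτ v]
      generalize τ u = a at huv
      generalize τ v = b at huv
      obtain ⟨a, j⟩ := a
      obtain ⟨b, k⟩ := b
      obtain rfl : a = b := huv
      exact ⟨a, j, k, rfl⟩
    linarith [(abs_lt.1 (hgram u v)).1]
  · intro u v huv
    have h1 : x u ⬝ᵥ x v ≤ p := by
      refine hAff.between.2 ?_
      rw [← hτ u, ← hτ v]
      exact ⟨(τ u).1, (τ v).1, huv, (τ u).2, (τ v).2, rfl⟩
    linarith [(abs_lt.1 (hgram u v)).2]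
  · intro i
    have hK : Nonempty (Fin (K i)) := by
      by_contra h
      rw [not_nonempty_iff] at h
      simpa using P.blockWeight_sum i
    obtain ⟨j⟩ := hK
    have h1 : 0 < P.blockCount x ⟨i, j⟩ := lt_of_lt_of_le (by positivity) (hcount ⟨i, j⟩)
    obtain ⟨v, -, hv⟩ := Finset.exists_ne_zero_of_sum_ne_zero h1.ne'
    have h2 : x v = P.ξ ⟨i, j⟩ := by
      by_contra h
      exact hv (Set.indicator_of_notMem (s := {P.ξ ⟨i, j⟩}) h _)
    refine ⟨v, ?_⟩
    have : τ v = ⟨i, j⟩ := P.distinct ((hτ v).trans h2)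
    change (τ v).1 = i
    rw [this]

/-- The probability that the graph is not supported, has a small block or is not concentrated. -/
theorem HSBM.measureReal_bad_le (P : HSBM R K d) {Ω : Type*} [MeasurableSpace Ω] {n : ℕ}
    {μ : Measure Ω} [IsProbabilityMeasure μ] {X : Ω → Fin n → (Σ i, Fin (d i)) → ℝ}
    {A : Ω → SimpleGraph (Fin n)} (h : IsRDPG μ P.distribution X A) (hn : 0 < n) {β ε : ℝ}
    (hβ : 0 < β) (hβP : ∀ a, 2 * β ≤ P.blockProb a) (hε : 0 < ε) :
    μ.real {ω | ¬(P.IsSupported (X ω) ∧ (∀ a, β * n ≤ P.blockCount (X ω) a) ∧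
      IsConcentrated (X ω) (A ω) ε)} ≤
      Fintype.card (Σ i, Fin (K i)) * (2 * Real.exp (-(β ^ 2 / 2) * n)) +
        (n * Fintype.card (Σ i, Fin (d i)) + n * n) * (2 * Real.exp (-(ε ^ 2 / 2) * n)) := by
  classical
  set B₁ := {ω | ¬P.IsSupported (X ω)} with hB₁
  set B₂ := ⋃ a, {ω | P.blockCount (X ω) a < β * n} with hB₂
  set B₃ := {ω | X ω ∈ {x | P.IsSupported x ∧ ¬IsConcentrated x (A ω) ε}} with hB₃
  have hsub : {ω | ¬(P.IsSupported (X ω) ∧ (∀ a, β * n ≤ P.blockCount (X ω) a) ∧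
      IsConcentrated (X ω) (A ω) ε)} ⊆ (B₁ ∪ B₂) ∪ B₃ := by
    intro ω hω
    by_contra hnot
    simp only [Set.mem_union, not_or] at hnot
    obtain ⟨⟨h1, h2⟩, h3⟩ := hnot
    have h1' : P.IsSupported (X ω) := not_not.1 h1
    refine hω ⟨h1', fun a => ?_, ?_⟩
    · by_contra h4
      exact h2 (Set.mem_iUnion.2 ⟨a, not_le.1 h4⟩)
    · by_contra h4
      exact h3 ⟨h1', h4⟩
  have hmap : ∀ S, MeasurableSet S → μ.real (X ⁻¹' S) =
      (Measure.pi fun _ : Fin n => P.distribution).real S := fun S hS => by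
    rw [measureReal_def, measureReal_def, ← h.map_latent, Measure.map_apply h.measurable_latent hS]
  have m₁ : μ.real B₁ = 0 := by
    have hm : MeasurableSet {x : Fin n → (Σ i, Fin (d i)) → ℝ | ¬P.IsSupported x} :=
      (P.finite_isSupported n).measurableSet.compl
    refine (hmap _ hm).trans ?_
    rw [measureReal_def, P.measure_not_isSupported, ENNReal.toReal_zero]
  have m₂ : μ.real B₂ ≤ Fintype.card (Σ i, Fin (K i)) * (2 * Real.exp (-(β ^ 2 / 2) * n)) := by
    refine (measureReal_iUnion_fintype_le _).trans ?_
    refine (Finset.sum_le_sum (g := fun _ => 2 * Real.exp (-(β ^ 2 / 2) * n))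
      fun a _ => ?_).trans_eq ?_
    · exact (hmap _ (measurableSet_lt (P.measurable_blockCount a) measurable_const)).trans_le
        (P.measureReal_blockCount_lt_le hn hβ (hβP a))
    · simp
  have m₃ : μ.real B₃ ≤
      (n * Fintype.card (Σ i, Fin (d i)) + n * n) * (2 * Real.exp (-(ε ^ 2 / 2) * n)) := by
    refine ENNReal.toReal_le_of_le_ofReal (by positivity)
      (h.measure_le (B := fun G => {x | P.IsSupported x ∧ ¬IsConcentrated x G ε})
        (fun G => ((P.finite_isSupported n).subset fun x hx => hx.1).measurableSet)
        fun x S hS => ?_)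
    -- Being supported does not depend on the graph, so a single member of `S` puts the inner
    -- products of `x` in `[0, 1]`.
    rcases S.eq_empty_or_nonempty with rfl | ⟨G, hGS⟩
    · simp
    · exact sum_edgeLikelihood_not_isConcentrated_le (hS G hGS).1.dotProduct_mem hε S
        fun G hG => (hS G hG).2
  calc _ ≤ μ.real ((B₁ ∪ B₂) ∪ B₃) := measureReal_mono hsub
    _ ≤ (μ.real B₁ + μ.real B₂) + μ.real B₃ :=
        (measureReal_union_le _ _).trans (add_le_add_left (measureReal_union_le _ _) _)
    _ ≤ _ := by linarith

end Main

theorem mainTheorem5 {R : ℕ} {K d : Fin R → ℕ} (P : HSBM R K d) (p q : ℝ)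
    (hAff : P.Affinity p q) (hSub : P.SubspaceStructure p)
    (hRank : (secondMoment P.distribution).rank = ∑ i, d i)
    {Ω : ℕ → Type*} [∀ n, MeasurableSpace (Ω n)]
    (μ : ∀ n, MeasureTheory.Measure (Ω n)) [∀ n, MeasureTheory.IsProbabilityMeasure (μ n)]
    (X : ∀ n, Ω n → Fin n → (Σ i, Fin (d i)) → ℝ) (A : ∀ n, Ω n → SimpleGraph (Fin n))
    (hRDPG : ∀ n, IsRDPG (μ n) P.distribution (X n) (A n))
    (S₀ : ∀ n, Ω n → Finset (Fin n))
    (hS₀_meas : ∀ n s, MeasurableSet {ω | S₀ n ω = s})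
    (hS₀_card : ∀ n, R ≤ n → ∀ ω, (S₀ n ω).card = R) :
    OccursAAS μ fun n => {ω |
      ∀ Xhat : Matrix (Fin n) (Fin (∑ i, d i)) ℝ,
        IsASE (open scoped Classical in (A n ω).adjMatrix ℝ) Xhat →
        ∀ Sn, IsFinalSeedSet Xhat (S₀ n ω) Sn →
          ∀ i, HasExactlyOne Xhat Sn (P.subgraph (X n ω) i)} := by
  obtain ⟨c, hc0, hc⟩ := P.exists_coercive hRank
  obtain ⟨β, hβ, hβP⟩ : ∃ β : ℝ, 0 < β ∧ ∀ a, 2 * β ≤ P.blockProb a := by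
    rcases isEmpty_or_nonempty (Σ i, Fin (K i)) with hE | hE
    · exact ⟨1, one_pos, fun a => (hE.false a).elim⟩
    · obtain ⟨a₀, ha₀⟩ := Finite.exists_min P.blockProb
      exact ⟨P.blockProb a₀ / 2, half_pos (P.blockProb_pos a₀), fun a => by linarith [ha₀ a]⟩
  have hm : 0 < c * β := mul_pos hc0 hβ
  have hqp : 0 < (q - p) / 2 := half_pos (sub_pos.2 hAff.lt)
  obtain ⟨e, he0, hec, hsmall⟩ : ∃ e : ℝ, 0 < e ∧ 4 * e ≤ c * β ∧
      8 * e / (c * β) ^ 2 + 3 * e / (c * β) < (q - p) / 2 := by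
    set k : ℝ := 8 / (c * β) ^ 2 + 3 / (c * β) with hk
    have hk0 : 0 < k := by positivity
    -- The error is `e * k`; the extra factor `2` in the denominator makes the inequality strict.
    refine ⟨min (c * β / 4) ((q - p) / 2 / (2 * k)), by positivity, ?_, ?_⟩
    · linarith [min_le_left (c * β / 4) ((q - p) / 2 / (2 * k))]
    · have h1 := mul_le_mul_of_nonneg_right
        (min_le_right (c * β / 4) ((q - p) / 2 / (2 * k))) hk0.le
      have h2 : (q - p) / 2 / (2 * k) * k = (q - p) / 2 / 2 := by field_simp
      have h3 : ∀ e : ℝ, 8 * e / (c * β) ^ 2 + 3 * e / (c * β) = e * k := fun e => by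
        rw [hk]; ring
      rw [h3]
      linarith
  set N : ℝ := Nat.cast (Fintype.card (Σ i, Fin (d i))) with hN
  have hN0 : 0 ≤ N := Nat.cast_nonneg _
  obtain ⟨ε, hε, hε1, he⟩ : ∃ ε : ℝ, 0 < ε ∧ ε ≤ 1 ∧ 4 * (N + 1) * ε ≤ e ^ 2 := by
    refine ⟨min 1 (e ^ 2 / (4 * (N + 1))), by positivity, min_le_left _ _, ?_⟩
    calc 4 * (N + 1) * min 1 (e ^ 2 / (4 * (N + 1)))
        ≤ 4 * (N + 1) * (e ^ 2 / (4 * (N + 1))) := by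
          gcongr
          exact min_le_right _ _
      _ = e ^ 2 := by field_simp
  intro c' _
  -- The coefficient collects the three failure bounds after each power of `n` is raised to `n ^ 2`
  -- and both exponential rates are lowered to the smaller one.
  obtain ⟨n₁, hn₁⟩ := exists_nat_poly_mul_exp_le
    (2 * Fintype.card (Σ i, Fin (K i)) + 2 * N + 2) (κ := min (β ^ 2 / 2) (ε ^ 2 / 2))
    (by positivity) c'
  obtain ⟨n₂, hn₂⟩ := exists_nat_ge (2 / ε)
  refine ⟨max (max n₁ n₂) R, fun n hn η hη _ => ?_⟩
  have hnR : R ≤ n := (le_max_right _ _).trans hn.le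
  have hn1 : n₁ < n := lt_of_le_of_lt ((le_max_left _ _).trans (le_max_left _ _)) hn
  have hn2 : n₂ < n := lt_of_le_of_lt ((le_max_right _ _).trans (le_max_left _ _)) hn
  have hn0 : 0 < n := lt_of_le_of_lt (Nat.zero_le _) hn1
  have hεn : 2 ≤ ε * n := by
    have h1 : 2 / ε ≤ n := hn₂.trans (Nat.cast_le.2 hn2.le)
    rw [div_le_iff₀ hε] at h1
    linarith
  have hbad := P.measureReal_bad_le (hRDPG n) hn0 hβ hβP hε
  set Good := {ω | P.IsSupported (X n ω) ∧ (∀ a, β * n ≤ P.blockCount (X n ω) a) ∧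
    IsConcentrated (X n ω) (A n ω) ε} with hGood
  -- Subadditivity suffices here, so measurability of `Good` is not needed.
  have hone : 1 ≤ (μ n).real Good + (μ n).real Goodᶜ := by
    calc (1 : ℝ) = (μ n).real (Good ∪ Goodᶜ) := by rw [Set.union_compl_self, MeasureTheory.probReal_univ]
      _ ≤ _ := MeasureTheory.measureReal_union_le _ _
  have hbound : (μ n).real Goodᶜ ≤ (n : ℝ) ^ (-c') := by
    refine le_trans (le_trans hbad ?_) (hn₁ n hn1)
    have hx1 : Real.exp (-(β ^ 2 / 2) * n) ≤
        Real.exp (-min (β ^ 2 / 2) (ε ^ 2 / 2) * n) := by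
      gcongr; exact min_le_left _ _
    have hx2 : Real.exp (-(ε ^ 2 / 2) * n) ≤
        Real.exp (-min (β ^ 2 / 2) (ε ^ 2 / 2) * n) := by
      gcongr; exact min_le_right _ _
    set z := Real.exp (-min (β ^ 2 / 2) (ε ^ 2 / 2) * n)
    have hz : 0 ≤ z := (Real.exp_pos _).le
    have hnn : (1 : ℝ) ≤ n := Nat.one_le_cast.2 hn0
    have hnn2 : (n : ℝ) ≤ n ^ 2 := by nlinarith
    calc _ ≤ Fintype.card (Σ i, Fin (K i)) * (2 * z) + (n * N + n * n) * (2 * z) := by gcongr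
      _ ≤ Fintype.card (Σ i, Fin (K i)) * (n ^ 2 * (2 * z)) +
            (n ^ 2 * N + n * n) * (2 * z) := by
          have h2z : 2 * z ≤ n ^ 2 * (2 * z) :=
            le_mul_of_one_le_left (by positivity) (hnn.trans hnn2)
          refine add_le_add (mul_le_mul_of_nonneg_left h2z (Nat.cast_nonneg _)) ?_
          gcongr
      _ = _ := by ring
  refine le_trans (by linarith) (MeasureTheory.measureReal_mono (s₁ := Good) ?_)
  rintro ω ⟨h1, h2, h3⟩ Xhat hX Sn hSn i
  exact P.hasExactlyOne_of_isConcentrated hAff h1 hc0 hβ hc h2 hε hε1 he0.le he hec hsmall hεn h3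
    hX (hS₀_card n hnR ω) hSn i
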